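/- **Setting.** Let $d\in\{2,3\}$ and let $\Omega\subset\mathbb R^d$ be a bounded polytopal domain with a conforming polytopal mesh: open connected cells $K\in\mathcal M$, flat relatively open connected faces $\sigma\in\mathcal F$, edges $e\in\mathcal E$ and nodes $s\in\mathcal V$ with positions $\mathbf x_s$ (for $d=2$ the edges of a face are its two end points); each face belongs to two cells (interior face) or to one cell (boundary face). $\mathcal F_K,\mathcal E_\sigma,\mathcal V_K,\mathcal V_\sigma$ denote the faces of $K$, the edges of $\sigma$, the nodes of $K$ and of $\sigma$. Let $\mathbf n_{K\sigma}$ be the unit normal to $\sigma$ outward of $K$, and $\mathbf n_{\sigma e}$ the unit normal to $e$ in the plane of $\sigma$ outward of $\sigma$. Let $\mathcal F_\Gamma$ be a set of interior faces (the fracture faces, $\overline\Gamma=\bigcup_{\sigma\in\mathcal F_\Gamma}\overline\sigma$), each with a chosen unit normal $\mathbf n^+$, and $\mathcal F_{\Gamma,K}^+=\{\sigma\in\mathcal F_\Gamma\cap\mathcal F_K:\ \mathbf n_{K\sigma}\cdot\mathbf n^+>0\}$. Let $\omega_s^K\ge 0$ $(s\in\mathcal V_K)$ and $\omega_s^\sigma\ge0$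 $(s\in\mathcal V_\sigma)$ be weights with sum $1$ such that $\overline{\mathbf x}_K=\sum_{s\in\mathcal V_K}\omega_s^K\mathbf x_s$ and $\overline{\mathbf x}_\sigma=\sum_{s\in\mathcal V_\sigma}\omega_s^\sigma\mathbf x_s$ are the centers of mass of $K$ and $\sigma$. **Discrete displacements.** For a node $s$ of $K$, let $\mathcal Ks$ be the set of the cells around $s$ that lie on the same side of $\overline\Gamma$ as $K$, i.e. in the same connected component of the union of the closed cells around $s$ minus $\overline\Gamma$. A discrete displacement $\mathbf v_{\mathcal D}\in\mathbf U_{\mathcal D}$ consists of vectors $\mathbf v_{\mathcal Ks}\in\mathbb R^d$, one for each node $s$ and each such set, and of vectors $\mathbf v_{K\sigma}\in\mathbb R^d$, one for each $K\in\mathcal M$ and $\sigma\in\mathcal F_{\Gamma,K}^+$. Set $$\overline{\mathbf v}_{K\sigma}=\sum_{s\in\mathcal V_\sigma}\omega_s^\sigma\mathbf v_{\mathcal Ks},\qquad \overline{\mathbf v}_K=\sum_{s\in\mathcal V_K}\omega_s^K\mathbf v_{\mathcal Ks},$$ $$\nabla^{K\sigma}\mathbf v_{\mathcal D}=\frac1{|\sigma|}\sum_{e=s_1s_2\in\mathcal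 E_\sigma}|e|\,\frac{\mathbf v_{\mathcal Ks_1}+\mathbf v_{\mathcal Ks_2}}2\otimes\mathbf n_{\sigma e},\qquad \Pi^{K\sigma}\mathbf v_{\mathcal D}(\mathbf x)=\nabla^{K\sigma}\mathbf v_{\mathcal D}(\mathbf x-\overline{\mathbf x}_\sigma)+\overline{\mathbf v}_{K\sigma},$$ $$\nabla^K\mathbf v_{\mathcal D}=\sum_{\sigma\in\mathcal F_{\Gamma,K}^+}\frac{|\sigma|}{|K|}\mathbf v_{K\sigma}\otimes\mathbf n_{K\sigma}+\sum_{\sigma\in\mathcal F_K}\frac{|\sigma|}{|K|}\overline{\mathbf v}_{K\sigma}\otimes\mathbf n_{K\sigma},\qquad \Pi^K\mathbf v_{\mathcal D}(\mathbf x)=\nabla^K\mathbf v_{\mathcal D}(\mathbf x-\overline{\mathbf x}_K)+\overline{\mathbf v}_K$$ (for $d=2$, where $e=\{s\}$, read $|e|=1$ and $s_1=s_2=s$). **Projectors and local spaces.** For a continuous $\mathbf v$ on $\overline K$, extended by zero, the interpolate $\mathcal I_{\mathcal D}\mathbf v\in\mathbf U_{\mathcal D}$ has on $K$ the components $(\mathcal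 I_{\mathcal D}\mathbf v)_{\mathcal Ks}=\mathbf v(\mathbf x_s)$ and $(\mathcal I_{\mathcal D}\mathbf v)_{K\sigma}=\frac1{|\sigma|}\int_\sigma(\mathbf v-\Pi^{K\sigma}\mathcal I^0\mathbf v)$, where $\mathcal I^0\mathbf v$ has the same nodal components and zero face components. Set $\pi^K\mathbf v=\Pi^K(\mathcal I_{\mathcal D}\mathbf v)\in\mathbb P^1(K)^d$ for $\mathbf v\in C^0(\overline K)^d$ and, likewise, $\pi^{K\sigma}\mathbf v=\Pi^{K\sigma}(\mathcal I_{\mathcal D}\mathbf v)\in\mathbb P^1(\sigma)^d$ for $\mathbf v\in C^0(\overline\sigma)^d$. Let $\mathbb Q_{K\sigma}=\mathbb P^1(\sigma)$ if $\sigma\notin\mathcal F_{\Gamma,K}^+$, and let $\mathbb Q_{K\sigma}$ be any complement of the constants in $\mathbb P^1(\sigma)$ if $\sigma\in\mathcal F_{\Gamma,K}^+$. With $\nabla_\tau$ and $\Delta_\tau$ the (weak) tangential gradient and Laplacian on $\sigma$, define $$\mathbf V_h^{K\sigma}=\Big\{\mathbf v\in C^0(\overline\sigma)^d\cap H^1(\sigma)^d:\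 \mathbf v_{|e}\in\mathbb P^1(e)^d\ \forall e\in\mathcal E_\sigma;\ \Delta_\tau\mathbf v\in\mathbb P^1(\sigma)^d;\ \int_\sigma\pi^{K\sigma}\mathbf v\cdot\mathbf p=\int_\sigma\mathbf v\cdot\mathbf p\ \ \forall\mathbf p\in(\mathbb Q_{K\sigma})^d\Big\},$$ $$\mathbf V_h^K=\Big\{\mathbf v\in C^0(\overline K)^d\cap H^1(K)^d:\ \mathbf v_{|\sigma}\in\mathbf V_h^{K\sigma}\ \forall\sigma\in\mathcal F_K;\ \Delta\mathbf v\in\mathbb P^1(K)^d;\ \int_K\pi^K\mathbf v\cdot\mathbf p=\int_K\mathbf v\cdot\mathbf p\ \ \forall\mathbf p\in\mathbb P^1(K)^d\Big\}.$$ **Lemma.** Let $K\in\mathcal M$. For every $\mathbf v\in\mathbf V_h^K$, $\pi^K\mathbf v$ is the elliptic projection of $\mathbf v$ on $\mathbb P^1(K)^d$, that is, the unique element of $\mathbb P^1(K)^d$ such that $$\int_K\nabla(\pi^K\mathbf v):\nabla\mathbf q=\int_K\nabla\mathbf v:\nabla\mathbf q\quad\forall\mathbf q\in\mathbb P^1(K)^d,\qquad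 (\pi^K\mathbf v)(\overline{\mathbf x}_K)=\sum_{s\in\mathcal V_K}\omega_s^K\,\mathbf v(\mathbf x_s).$$ For every $\sigma\in\mathcal F_K$ and every $\mathbf v\in\mathbf V_h^{K\sigma}$, $\pi^{K\sigma}\mathbf v$ is the elliptic projection of $\mathbf v$ on $\mathbb P^1(\sigma)^d$ for the tangential gradient, that is, the unique element of $\mathbb P^1(\sigma)^d$ such that $$\int_\sigma\nabla_\tau(\pi^{K\sigma}\mathbf v):\nabla_\tau\mathbf q=\int_\sigma\nabla_\tau\mathbf v:\nabla_\tau\mathbf q\quad\forall\mathbf q\in\mathbb P^1(\sigma)^d,\qquad (\pi^{K\sigma}\mathbf v)(\overline{\mathbf x}_\sigma)=\sum_{s\in\mathcal V_\sigma}\omega_s^\sigma\,\mathbf v(\mathbf x_s).$$ -/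

import Mathlib

open Set MeasureTheory
open scoped ContDiff RealInnerProductSpace

noncomputable section

namespace BubbleVEM

/-- The Euclidean space `ℝ^d`. -/
abbrev E (d : ℕ) : Type := EuclideanSpace ℝ (Fin d)

/-! ### Linear algebra: tensor product of vectors, Frobenius product -/

/-- The tensor product `a ⊗ n`, i.e. the matrix `a nᵀ`, as the linear map `x ↦ (n · x) a`. -/
def tensor {d : ℕ} (a n : E d) : E d →L[ℝ] E d :=
  (innerSL ℝ n).smulRight a

/-- The Frobenius product `A : B = ∑ i j, A i j * B i j`, computed column by column. -/
def frob {d : ℕ} (A B : E d →L[ℝ] E d) : ℝ :=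
  ∑ j : Fin d, ⟪A (EuclideanSpace.single j 1), B (EuclideanSpace.single j 1)⟫

/-! ### Calculus on flat pieces

In this part `A` is a set which is relatively open in its affine span: either a cell (an open subset
of `ℝ^d`, whose affine span is `ℝ^d`), or a face (a relatively open subset of a hyperplane), and `μ`
is the corresponding Lebesgue measure: `volume` for a cell, the surface measure
`μHE[d - 1]` for a face. The directions tangent to `A` are those of `vectorSpan ℝ A`,
which is everything if `A` is a cell. -/

/-- The (tangential) gradient along `A` at `x` of a differentiable map `f`: its derivative,
restricted to the directions tangent to `A` and extended by zero in the normal directions.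
It is the usual gradient if `A` is open. -/
def tgrad {d : ℕ} (A : Set (E d)) (f : E d → E d) (x : E d) : E d →L[ℝ] E d :=
  (fderiv ℝ f x).comp (vectorSpan ℝ A).starProjection

/-- `φ` is (a smooth extension to `ℝ^d` of) a test function in `C_c^∞(A)`. -/
structure IsTestFunction {d : ℕ} (A : Set (E d)) (φ : E d → ℝ) : Prop where
  smooth : ContDiff ℝ ∞ φ
  compact : HasCompactSupport φ
  support : tsupport φ ∩ closure A ⊆ A

/-- `G` is the weak (tangential) gradient of `v` on `A`, and it is square integrable. For a `v`
which is continuous on the compact set `closure A`, this says that `v ∈ H^1(A)^d`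
and `∇_τ v = G`. -/
structure HasWeakGrad {d : ℕ} (A : Set (E d)) (μ : Measure (E d)) (v : E d → E d)
    (G : E d → E d →L[ℝ] E d) : Prop where
  memLp : MemLp G 2 (μ.restrict A)
  tangential : ∀ᵐ x ∂(μ.restrict A), ∀ w ∈ (vectorSpan ℝ A)ᗮ, G x w = 0
  integral_eq : ∀ φ : E d → ℝ, IsTestFunction A φ → ∀ τ ∈ vectorSpan ℝ A,
    ∫ x in A, (fderiv ℝ φ x τ) • v x ∂μ = - ∫ x in A, φ x • G x τ ∂μ

/-- `v` has a square integrable weak gradient on `A` (for a `v` continuous on `closure A`,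
this is `v ∈ H^1(A)^d`) and its weak (tangential) Laplacian, the weak divergence of that gradient,
belongs to `ℙ^1(A)^d`. -/
def H1WithAffineLaplacian {d : ℕ} (A : Set (E d)) (μ : Measure (E d)) (v : E d → E d) : Prop :=
  ∃ G : E d → E d →L[ℝ] E d, HasWeakGrad A μ v G ∧ ∃ p : E d →ᵃ[ℝ] E d,
    ∀ φ : E d → ℝ, IsTestFunction A φ →
      ∫ x in A, G x (gradient φ x) ∂μ = - ∫ x in A, φ x • p x ∂μ

/-- The space `ℙ^1(A)` of real functions on `A` which are restrictions of affine functions. -/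
def affineFun {d : ℕ} (A : Set (E d)) : Submodule ℝ (A → ℝ) where
  carrier := {f | ∃ p : E d →ᵃ[ℝ] ℝ, ∀ x : A, f x = p x}
  add_mem' := by
    rintro f g ⟨p, hp⟩ ⟨q, hq⟩
    exact ⟨p + q, fun x => by simp [hp, hq]⟩
  zero_mem' := ⟨0, fun x => by simp⟩
  smul_mem' := by
    rintro c f ⟨p, hp⟩
    exact ⟨c • p, fun x => by simp [hp]⟩

/-- The space `ℙ^0(A)` of constant real functions on `A`. -/
def constFun {d : ℕ} (A : Set (E d)) : Submodule ℝ (A → ℝ) where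
  carrier := {f | ∃ c : ℝ, ∀ x : A, f x = c}
  add_mem' := by
    rintro f g ⟨a, ha⟩ ⟨b, hb⟩
    exact ⟨a + b, fun x => by simp [ha, hb]⟩
  zero_mem' := ⟨0, fun x => by simp⟩
  smul_mem' := by
    rintro c f ⟨a, ha⟩
    exact ⟨c * a, fun x => by simp [ha]⟩

/-- The affine map `x ↦ L (x - c) + b`. -/
def affineAt {d : ℕ} (L : E d →L[ℝ] E d) (c b : E d) : E d →ᵃ[ℝ] E d where
  toFun x := L (x - c) + b
  linear := L
  map_vadd' p v := by
    have h : v + p - c = v + (p - c) := by abel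
    simp [h, add_assoc]

/-- `w ∈ ℙ^1(A)^d` is an elliptic projection of `v` on `A`, with the value at the point `c` prescribed
to be `m`: `∫_A ∇_τ w : ∇_τ q = ∫_A ∇_τ v : ∇_τ q` for all `q ∈ ℙ^1(A)^d`,
and `w(c) = m`. -/
def IsEllipticProjection {d : ℕ} (A : Set (E d)) (μ : Measure (E d)) (c m : E d)
    (v : E d → E d) (w : E d →ᵃ[ℝ] E d) : Prop :=
  (∀ G : E d → E d →L[ℝ] E d, HasWeakGrad A μ v G → ∀ q : E d →ᵃ[ℝ] E d,
    ∫ x in A, frob (tgrad A w x) (tgrad A q x) ∂μ = ∫ x in A, frob (G x) (tgrad A q x) ∂μ) ∧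
  w c = m

/-! ### Polytopal meshes -/

/-- `n` is the unit vector, tangent to `A`, normal to the flat boundary piece `B` of `A` and pointing
outward of `A`; near each point of `B`, the set `A` lies exactly on the inner side of `B`. -/
structure IsOutwardNormal {d : ℕ} (A B : Set (E d)) (n : E d) : Prop where
  norm_eq : ‖n‖ = 1
  tangent : n ∈ vectorSpan ℝ A
  orthogonal : n ∈ (vectorSpan ℝ B)ᗮ
  oneSided : ∀ x ∈ B, ∃ r > 0,
    A ∩ Metric.ball x r = {y ∈ Metric.ball x r | y ∈ affineSpan ℝ A ∧ ⟪n, y - x⟫ < 0}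

/-- A conforming polytopal mesh of a bounded polytopal domain `Ω ⊆ ℝ^d`, `d ∈ {2, 3}`, together with
a fracture network made of interior faces.

Cells are open, faces are relatively open in hyperplanes, edges are open segments between
two nodes if `d = 3`. If `d = 2` the faces are segments, and their edges are their end points: an edge
is then a singleton `{s}`, `s` a node. Incidence is inclusion (of closures), so that the fields below
say that the boundary of a cell is made of its faces, and the boundary of a face of its edges. -/
structure PolytopalMesh (d : ℕ) where
  /-- the domain -/
  Ω : Set (E d)
  /-- the cells -/
  cells : Finset (Set (E d))
  /-- the faces -/
  faces : Finset (Set (E d))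
  /-- the edges -/
  edges : Finset (Set (E d))
  /-- the nodes (the node `s` is identified with its position `x_s`) -/
  nodes : Finset (E d)
  isOpen_domain : IsOpen Ω
  isConnected_domain : IsConnected Ω
  isBounded_domain : Bornology.IsBounded Ω
  isOpen_cell : ∀ K ∈ cells, IsOpen K
  isConnected_cell : ∀ K ∈ cells, IsConnected K
  cell_subset : ∀ K ∈ cells, K ⊆ Ω
  closure_domain : closure Ω = ⋃ K ∈ cells, closure K
  cells_disjoint : (cells : Set (Set (E d))).PairwiseDisjoint id
  isConnected_face : ∀ σ ∈ faces, IsConnected σ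
  face_dim : ∀ σ ∈ faces, Module.finrank ℝ (vectorSpan ℝ σ) + 1 = d
  face_relOpen : ∀ σ ∈ faces, ∃ U : Set (E d), IsOpen U ∧ σ = U ∩ affineSpan ℝ σ
  faces_disjoint : (faces : Set (Set (E d))).PairwiseDisjoint id
  edge_segment : ∀ e ∈ edges, ∃ s₁ ∈ nodes, ∃ s₂ ∈ nodes, (s₁ = s₂ ↔ d = 2) ∧
    e = openSegment ℝ s₁ s₂ ∧ ∀ s ∈ nodes, s ∈ closure e → s = s₁ ∨ s = s₂
  edges_disjoint : (edges : Set (Set (E d))).PairwiseDisjoint id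
  face_edge_disjoint : ∀ σ ∈ faces, ∀ e ∈ edges, Disjoint σ (closure e)
  node_edge : ∀ s ∈ nodes, ∃ e ∈ edges, s ∈ closure e
  edge_face : ∀ e ∈ edges, ∃ σ ∈ faces, e ⊆ closure σ
  /-- a face belongs either to exactly two cells, and it is then an interior face, ... -/
  face_cells : ∀ σ ∈ faces,
    (σ ⊆ Ω ∧ {K | K ∈ cells ∧ σ ⊆ closure K}.ncard = 2) ∨
    (σ ⊆ frontier Ω ∧ {K | K ∈ cells ∧ σ ⊆ closure K}.ncard = 1)
  frontier_cell : ∀ K ∈ cells,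
    frontier K = ⋃ σ ∈ {σ | σ ∈ faces ∧ σ ⊆ closure K}, closure σ
  frontier_face : ∀ σ ∈ faces,
    closure σ \ σ = ⋃ e ∈ {e | e ∈ edges ∧ e ⊆ closure σ}, closure e
  /-- `normal K σ` is `n_{Kσ}` -/
  normal : Set (E d) → Set (E d) → E d
  normal_spec : ∀ K ∈ cells, ∀ σ ∈ faces, σ ⊆ closure K → IsOutwardNormal K σ (normal K σ)
  /-- `edgeNormal σ e` is `n_{σe}` -/
  edgeNormal : Set (E d) → Set (E d) → E d
  edgeNormal_spec : ∀ σ ∈ faces, ∀ e ∈ edges, e ⊆ closure σ →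
    IsOutwardNormal σ e (edgeNormal σ e)
  /-- the faces whose closures cover the closed fracture network -/
  fractureFaces : Finset (Set (E d))
  fractureFaces_subset : fractureFaces ⊆ faces
  fractureFaces_interior : ∀ σ ∈ fractureFaces, σ ⊆ Ω
  /-- `nPlus σ` is the normal `n⁺` on the fracture face `σ`, outward from the `+` side -/
  nPlus : Set (E d) → E d
  nPlus_spec : ∀ σ ∈ fractureFaces, ∃ K ∈ cells, σ ⊆ closure K ∧ nPlus σ = normal K σ

namespace PolytopalMesh

variable {d : ℕ} (M : PolytopalMesh d)

open Classical in
/-- `𝓕_K`: the faces of `K`. -/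
def facesOf (K : Set (E d)) : Finset (Set (E d)) := M.faces.filter fun σ => σ ⊆ closure K

open Classical in
/-- `𝓔_σ`: the edges of `σ`. -/
def edgesOf (σ : Set (E d)) : Finset (Set (E d)) := M.edges.filter fun e => e ⊆ closure σ

open Classical in
/-- `𝓥_A`: the nodes of `A` (a cell, a face or an edge). -/
def nodesOf (A : Set (E d)) : Finset (E d) := M.nodes.filter fun s => s ∈ closure A

open Classical in
/-- `𝓜_s`: the cells around the node `s`. -/
def cellsOf (s : E d) : Finset (Set (E d)) := M.cells.filter fun K => s ∈ closure K

open Classical in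
/-- `𝓕_{Γ,K}^+`: the fracture faces of `K` such that `K` is on their `+` side. -/
def plusFaces (K : Set (E d)) : Finset (Set (E d)) :=
  (M.facesOf K).filter fun σ => σ ∈ M.fractureFaces ∧ 0 < ⟪M.normal K σ, M.nPlus σ⟫

/-- The closed fracture network. -/
def closedNetwork : Set (E d) := ⋃ σ ∈ M.fractureFaces, closure σ

/-- `𝒦s`: the cells of `𝓜_s` on the same side of the fracture network as `K`, i.e. those contained in
the same connected component as `K` of the union of the closed cells around `s`
minus the network. -/
def side (K : Set (E d)) (s : E d) : Set (Set (E d)) :=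
  {L | L ∈ M.cellsOf s ∧ ∀ x ∈ K,
    L ⊆ connectedComponentIn ((⋃ L' ∈ M.cellsOf s, closure L') \ M.closedNetwork) x}

/-- The family of all `𝒦s` for a given node `s`. -/
def sides (s : E d) : Set (Set (Set (E d))) := {c | ∃ K ∈ M.cellsOf s, c = M.side K s}

/-- The space `U_𝓓` of discrete displacements: one vector for each node `s` and each `𝒦s`, and one
vector for each cell `K` and each `σ ∈ 𝓕_{Γ,K}^+`. -/
abbrev Displacement : Type :=
  (∀ s : M.nodes, M.sides s.1 → E d) × (∀ K : M.cells, M.plusFaces K.1 → E d)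

variable {M} in
lemma nodesOf_mono {A B : Set (E d)} (h : A ⊆ closure B) : M.nodesOf A ⊆ M.nodesOf B := by
  classical
  intro s hs
  simp only [nodesOf, Finset.mem_filter] at hs ⊢
  exact ⟨hs.1, closure_minimal h isClosed_closure hs.2⟩

variable {M} in
lemma face_subset_closure {K σ : Set (E d)} (h : σ ∈ M.facesOf K) : σ ⊆ closure K := by
  classical
  exact (Finset.mem_filter.1 h).2

variable {M} in
lemma edge_subset_closure {σ e : Set (E d)} (h : e ∈ M.edgesOf σ) : e ⊆ closure σ := by
  classical
  exact (Finset.mem_filter.1 h).2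

variable {M} in
/-- The nodal value `v_{𝒦s}` of a discrete displacement, for a node `s` of the cell `K`. -/
def nodalValue (u : M.Displacement) (K : M.cells) (s : M.nodesOf K.1) : E d :=
  u.1 ⟨s.1, by classical exact (Finset.mem_filter.1 s.2).1⟩
    ⟨M.side K.1 s.1, K.1, by
      classical
      exact Finset.mem_filter.2 ⟨K.2, (Finset.mem_filter.1 s.2).2⟩, rfl⟩

/-- Measure `|K|` of a cell. -/
def cellMeas (K : Set (E d)) : ℝ := (volume K).toReal

/-- `(d-1)`-dimensional measure `|σ|` of a face. -/
def faceMeas (σ : Set (E d)) : ℝ := (μHE[d - 1] σ).toReal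

/-- `(d-2)`-dimensional measure `|e|` of an edge: its length if `d = 3`, and `1` if `d = 2`. -/
def edgeMeas (e : Set (E d)) : ℝ := (μHE[d - 2] e).toReal

/-- Non-negative nodal weights associated with the centers of mass of the cells and of the faces. -/
structure NodalWeights where
  /-- `cell K s` is `ω_s^K` -/
  cell : Set (E d) → E d → ℝ
  /-- `face σ s` is `ω_s^σ` -/
  face : Set (E d) → E d → ℝ
  cell_nonneg : ∀ K ∈ M.cells, ∀ s ∈ M.nodesOf K, 0 ≤ cell K s
  cell_sum : ∀ K ∈ M.cells, ∑ s ∈ M.nodesOf K, cell K s = 1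
  cell_center : ∀ K ∈ M.cells,
    ∑ s ∈ M.nodesOf K, cell K s • s = (1 / cellMeas K) • ∫ x in K, x
  face_nonneg : ∀ σ ∈ M.faces, ∀ s ∈ M.nodesOf σ, 0 ≤ face σ s
  face_sum : ∀ σ ∈ M.faces, ∑ s ∈ M.nodesOf σ, face σ s = 1
  face_center : ∀ σ ∈ M.faces,
    ∑ s ∈ M.nodesOf σ, face σ s • s = (1 / faceMeas σ) • ∫ x in σ, x ∂μHE[d - 1]

variable {M} (wt : M.NodalWeights)

/-- The center of mass of `K`, as the weighted sum of its nodes. -/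
def cellCenter (K : Set (E d)) : E d := ∑ s ∈ M.nodesOf K, wt.cell K s • s

/-- The center of mass of `σ`, as the weighted sum of its nodes. -/
def faceCenter (σ : Set (E d)) : E d := ∑ s ∈ M.nodesOf σ, wt.face σ s • s

/-! ### Reconstruction operators -/

/-- The weighted nodal mean of a discrete displacement on the face `σ` of `K`. -/
def faceMean (u : M.Displacement) (K : M.cells) (σ : M.facesOf K.1) : E d :=
  ∑ s : M.nodesOf σ.1,
    wt.face σ.1 s.1 • nodalValue u K ⟨s.1, nodesOf_mono (face_subset_closure σ.2) s.2⟩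

/-- The weighted nodal mean of a discrete displacement on the cell `K`. -/
def cellMean (u : M.Displacement) (K : M.cells) : E d :=
  ∑ s : M.nodesOf K.1, wt.cell K.1 s.1 • nodalValue u K s

/-- The mean of the nodal values at the nodes of an edge `e` of a face `σ` of `K`:
`(v_{𝒦s₁} + v_{𝒦s₂}) / 2` if `d = 3` (where `e = s₁s₂`), and `v_{𝒦s}` if `d = 2`
(where `e = {s}`). -/
def edgeMean (u : M.Displacement) (K : M.cells) (σ : M.facesOf K.1) (e : M.edgesOf σ.1) : E d :=
  (1 / ((M.nodesOf e.1).card : ℝ)) • ∑ s : M.nodesOf e.1,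
    nodalValue u K ⟨s.1, nodesOf_mono (face_subset_closure σ.2)
      (nodesOf_mono (edge_subset_closure e.2) s.2)⟩

/-- The tangential gradient reconstruction `∇^{Kσ}`. -/
def faceGrad (u : M.Displacement) (K : M.cells) (σ : M.facesOf K.1) : E d →L[ℝ] E d :=
  (1 / faceMeas σ.1) • ∑ e : M.edgesOf σ.1,
    edgeMeas e.1 • tensor (edgeMean u K σ e) (M.edgeNormal σ.1 e.1)

/-- The linear reconstruction `Π^{Kσ}` on the face `σ` of `K`. -/
def faceRec (u : M.Displacement) (K : M.cells) (σ : M.facesOf K.1) : E d →ᵃ[ℝ] E d :=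
  affineAt (faceGrad u K σ) (faceCenter wt σ.1) (faceMean wt u K σ)

/-- The gradient reconstruction `∇^K`. -/
def cellGrad (u : M.Displacement) (K : M.cells) : E d →L[ℝ] E d :=
  (∑ σ : M.plusFaces K.1,
    (faceMeas σ.1 / cellMeas K.1) • tensor (u.2 K σ) (M.normal K.1 σ.1)) +
  ∑ σ : M.facesOf K.1,
    (faceMeas σ.1 / cellMeas K.1) • tensor (faceMean wt u K σ) (M.normal K.1 σ.1)

/-- The linear reconstruction `Π^K`. -/
def cellRec (u : M.Displacement) (K : M.cells) : E d →ᵃ[ℝ] E d :=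
  affineAt (cellGrad wt u K) (cellCenter wt K.1) (cellMean wt u K)

/-! ### Interpolators and projectors

The interpolators are applied to functions which are given only on a closed cell (or on a closed face
of that cell), and extended by zero. -/

open Classical in
/-- The nodal interpolator of a function which is given on the side of the cell `K` and extended by
zero: the value at `𝓛s` is `v_{|K}(x_s)` if `𝓛s = 𝒦s` and `0` otherwise; no bubble component. -/
def nodalInterp (K : M.cells) (v : E d → E d) : M.Displacement :=
  (fun s c => if c.1 = M.side K.1 s.1 then v s.1 else 0, 0)

open Classical in
/-- The interpolator `I_𝓓` of a function which is given on the side of the cell `K` and extended by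
zero: nodal values as above, and `(1/|σ|) ∫_σ (γ^{Lσ} v - Π^{Lσ}(nodal interpolate of v))`
for each cell `L` and `σ ∈ 𝓕_{Γ,L}^+`, where `γ^{Lσ} v = 0` if `L ≠ K`. -/
def interp (K : M.cells) (v : E d → E d) : M.Displacement :=
  ((nodalInterp K v).1, fun L σ => (1 / faceMeas σ.1) • ∫ x in σ.1,
    ((if L = K then v x else 0) -
      faceRec wt (nodalInterp K v) L ⟨σ.1, (Finset.mem_filter.1 σ.2).1⟩ x) ∂μHE[d - 1])

/-- The projector `π^K = Π^K ∘ I_𝓓` on `C^0(closure K)^d`. -/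
def cellProj (K : M.cells) (v : E d → E d) : E d →ᵃ[ℝ] E d :=
  cellRec wt (interp wt K ((closure K.1).indicator v)) K

/-- The projector `π^{Kσ} = Π^{Kσ} ∘ I_𝓓` on `C^0(closure σ)^d`. -/
def faceProj (K : M.cells) (σ : M.facesOf K.1) (v : E d → E d) : E d →ᵃ[ℝ] E d :=
  faceRec wt (interp wt K ((closure σ.1).indicator v)) K σ

/-! ### Local virtual element spaces -/

variable (M) in
/-- `Q K σ` is, for each `σ ∈ 𝓕_{Γ,K}^+`, a complement of the constants in `ℙ^1(σ)`. -/
def IsBubbleComplement (Q : Set (E d) → (σ : Set (E d)) → Submodule ℝ (σ → ℝ)) : Prop :=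
  ∀ K ∈ M.cells, ∀ σ ∈ M.plusFaces K,
    constFun σ ⊔ Q K σ = affineFun σ ∧ constFun σ ⊓ Q K σ = ⊥

open Classical in
variable (M) in
/-- The space of scalar test functions on `σ`: `ℙ^1(σ)` if `σ ∉ 𝓕_{Γ,K}^+`, and the chosen
complement of the constants otherwise. -/
def faceTest (Q : Set (E d) → (σ : Set (E d)) → Submodule ℝ (σ → ℝ)) (K σ : Set (E d)) :
    Submodule ℝ (σ → ℝ) :=
  if σ ∈ M.plusFaces K then Q K σ else affineFun σ

/-- The face space `V_h^{Kσ}`. Its elements are functions on `closure σ`; they are represented by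
functions on `ℝ^d`, of which only the values on `closure σ` matter. -/
def faceSpace (Q : Set (E d) → (σ : Set (E d)) → Submodule ℝ (σ → ℝ))
    (K : M.cells) (σ : M.facesOf K.1) : Set (E d → E d) :=
  {v | ContinuousOn v (closure σ.1) ∧
    (∀ e ∈ M.edgesOf σ.1, ∃ p : E d →ᵃ[ℝ] E d, EqOn v p e) ∧
    H1WithAffineLaplacian σ.1 μHE[d - 1] v ∧
    ∀ p : E d →ᵃ[ℝ] E d, (∀ i, (fun x : σ.1 => p x i) ∈ M.faceTest Q K.1 σ.1) →
      ∫ x in σ.1, ⟪faceProj wt K σ v x, p x⟫ ∂μHE[d - 1] = ∫ x in σ.1, ⟪v x, p x⟫ ∂μHE[d - 1]}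

/-- The cell space `V_h^K`, whose elements are functions on `closure K`; they are represented by
functions on `ℝ^d`, of which only the values on `closure K` matter. -/
def cellSpace (Q : Set (E d) → (σ : Set (E d)) → Submodule ℝ (σ → ℝ)) (K : M.cells) :
    Set (E d → E d) :=
  {v | ContinuousOn v (closure K.1) ∧
    (∀ σ : M.facesOf K.1, v ∈ faceSpace wt Q K σ) ∧
    H1WithAffineLaplacian K.1 volume v ∧
    ∀ p : E d →ᵃ[ℝ] E d,
      ∫ x in K.1, ⟪cellProj wt K v x, p x⟫ = ∫ x in K.1, ⟪v x, p x⟫}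

end PolytopalMesh

end BubbleVEM

end

/-!
The projector `π^K v` has the prescribed value at the center of mass by construction, so the point is
that its constant gradient is the mean value over `K` of the weak gradient of `v`; testing with affine
maps, whose gradients are arbitrary constant matrices, shows that this characterizes the elliptic
projection (`isEllipticProjection_iff`, `eqOn_affineAt_iff`). The same holds on a face.

By the divergence theorem, the integral of the weak gradient is the sum over the boundary pieces `B`
of `(∫_B v) ⊗ n_B`. On a face `σ`, the pieces are the edges, on which `v` is affine, so that `∫_e v` is
given by the nodal values (`integral_edge_eq`). On a cell, the pieces are the faces, and `∫_σ v` is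
recovered from the discrete unknowns: either it is prescribed by the moment conditions, the constants
being admissible test functions (`integral_face_of_notMem`), or it is encoded in the bubble component of
the interpolate (`integral_face_of_mem`).

The divergence theorem needed here (`IsFlatPiece.integral_weakGrad`) is for a function which is continuous
up to the boundary and has a square integrable weak gradient, on a polytope which need not be a
Lipschitz domain. It is proved simultaneously for cells and faces, as relatively open subsets `A` of
affine subspaces of dimension `m + 1` carrying the Hausdorff measure.
* Near a point of a boundary piece, `A` is a half-space. A test function is multiplied by a cut-off of
  the scaled distance to the bounding hyperplane; the derivative of the cut-off concentrates on the
  hyperplane and produces the boundary term (`tendsto_integral_layer`,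
  `IsFlatPiece.greenFormula_of_ball`).
* A partition of unity gives Green's formula for all test functions supported away from the remaining
  part `N` of the boundary (`IsFlatPiece.greenFormula_of_disjoint`).
* The set `N` has zero `m`-dimensional Hausdorff measure, so it is covered by balls with a small sum of
  `m`-th powers of the radii, and there are cut-off functions which vanish near `N` and have a small
  gradient in `L¹` (`exists_cutoff`). As `v` is bounded, `N` does not contribute in the limit.
-/

noncomputable section

namespace BubbleVEM

open Filter Topology Module

/-! ### Orthonormal coordinates on an affine subspace -/

section Coordinates

variable {d k : ℕ} {V : Submodule ℝ (E d)}

/-- The orthonormal coordinates with origin `x` on the affine subspace `x + V`. -/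
def chart (b : OrthonormalBasis (Fin k) ℝ V) (x : E d) (c : E k) : E d :=
  x + (b.repr.symm c : E d)

lemma isometry_chart (b : OrthonormalBasis (Fin k) ℝ V) (x : E d) : Isometry (chart b x) :=
  (isometry_add_left x).comp (isometry_subtype_coe.comp b.repr.symm.isometry)

lemma range_chart (b : OrthonormalBasis (Fin k) ℝ V) (x : E d) :
    range (chart b x) = {y | y - x ∈ V} := by
  ext y
  constructor
  · rintro ⟨c, rfl⟩
    simp [chart]
  · intro hy
    exact ⟨b.repr ⟨y - x, hy⟩, by simp [chart]⟩

lemma map_chart (b : OrthonormalBasis (Fin k) ℝ V) (x : E d) :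
    (volume : Measure (E k)).map (chart b x) = μHE[k].restrict {y | y - x ∈ V} := by
  rw [← EuclideanSpace.euclideanHausdorffMeasure_eq_volume,
    (isometry_chart b x).map_euclideanHausdorffMeasure, range_chart]

lemma measurableEmbedding_chart (b : OrthonormalBasis (Fin k) ℝ V) (x : E d) :
    MeasurableEmbedding (chart b x) :=
  (isometry_chart b x).isClosedEmbedding.measurableEmbedding

/-- The `k`-dimensional measure of a ball in a `k`-dimensional affine subspace grows at most like the
`k`-th power of the radius, uniformly in the center, which need not lie in the subspace. -/
lemma exists_measure_closedBall_le (hV : finrank ℝ V = k) (x : E d) :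
    ∃ C : ℝ, 0 ≤ C ∧ ∀ z : E d, ∀ r : ℝ, 0 ≤ r →
      (μHE[k].restrict {y : E d | y - x ∈ V}) (Metric.closedBall z r) ≤
        ENNReal.ofReal (C * r ^ k) := by
  set c : ENNReal := volume (Metric.closedBall (0 : E k) 1) with hc
  have hcfin : c ≠ ⊤ := measure_closedBall_lt_top.ne
  refine ⟨2 ^ k * c.toReal, by positivity, fun z r hr => ?_⟩
  let b : OrthonormalBasis (Fin k) ℝ V := (stdOrthonormalBasis ℝ V).reindex (finCongr hV)
  rw [← map_chart b x, (measurableEmbedding_chart b x).map_apply]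
  rcases (chart b x ⁻¹' Metric.closedBall z r).eq_empty_or_nonempty with h | ⟨c₀, hc₀⟩
  · rw [h]; simp
  · have hsub : chart b x ⁻¹' Metric.closedBall z r ⊆ Metric.closedBall c₀ (2 * r) := by
      intro c' hc'
      rw [Metric.mem_closedBall, ← (isometry_chart b x).dist_eq]
      have h1 : dist (chart b x c') z ≤ r := hc'
      have h2 : dist (chart b x c₀) z ≤ r := hc₀
      linarith [dist_triangle_right (chart b x c') (chart b x c₀) z]
    refine (measure_mono hsub).trans ?_
    rw [Measure.addHaar_closedBall' volume c₀ (by positivity), finrank_euclideanSpace_fin, ← hc,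
      ← ENNReal.ofReal_toReal hcfin, ← ENNReal.ofReal_mul (by positivity),
      ENNReal.toReal_ofReal ENNReal.toReal_nonneg]
    apply ENNReal.ofReal_le_ofReal
    apply le_of_eq
    ring

lemma measure_lt_top_of_isBounded {B : Set (E d)} (hB : Bornology.IsBounded B)
    (hk : finrank ℝ (vectorSpan ℝ B) = k) : μHE[k] B < ⊤ := by
  rcases B.eq_empty_or_nonempty with rfl | ⟨x, hx⟩
  · simp
  obtain ⟨C, -, h⟩ := exists_measure_closedBall_le hk x
  obtain ⟨R, hR⟩ := hB.subset_closedBall x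
  have hsub : B ⊆ {y | y - x ∈ vectorSpan ℝ B} :=
    fun y hy => vsub_mem_vectorSpan ℝ hy hx
  have hcl : MeasurableSet {y : E d | y - x ∈ vectorSpan ℝ B} := by
    have : IsClosed ((vectorSpan ℝ B : Submodule ℝ (E d)) : Set (E d)) :=
      Submodule.closed_of_finiteDimensional _
    exact (this.preimage (continuous_id.sub continuous_const)).measurableSet
  calc μHE[k] B ≤ μHE[k] (Metric.closedBall x (max R 0) ∩ {y | y - x ∈ vectorSpan ℝ B}) :=
        measure_mono (subset_inter
          (hR.trans (Metric.closedBall_subset_closedBall (le_max_left _ _))) hsub)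
    _ = (μHE[k].restrict {y | y - x ∈ vectorSpan ℝ B}) (Metric.closedBall x (max R 0)) := by
        rw [Measure.restrict_apply' hcl]
    _ < ⊤ := (h x _ (le_max_right _ _)).trans_lt ENNReal.ofReal_lt_top

end Coordinates

/-! ### Cut-off functions near sets of codimension two -/

section Cutoff

variable {d : ℕ}

/-- A compact set of vanishing `m`-dimensional Hausdorff measure is covered by finitely many small
balls, centered on it, whose radii have an arbitrarily small sum of `m`-th powers. -/
lemma exists_finite_cover {N : Set (E d)} (hN : IsCompact N) {m : ℕ} (h0 : μH[m] N = 0)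
    {δ ρ : ℝ} (hδ : 0 < δ) (hρ : 0 < ρ) :
    ∃ (s : Finset ℕ) (z : ℕ → E d) (r : ℕ → ℝ), (∀ i ∈ s, z i ∈ N ∧ 0 < r i ∧ r i ≤ ρ) ∧
      N ⊆ ⋃ i ∈ s, Metric.ball (z i) (r i) ∧ ∑ i ∈ s, r i ^ m ≤ δ := by
  classical
  rcases N.eq_empty_or_nonempty with rfl | hne
  · exact ⟨∅, fun _ => 0, fun _ => 0, by simp, by simp, by simpa using hδ.le⟩
  have hm : m ≠ 0 := by
    rintro rfl
    have := Measure.one_le_hausdorffMeasure_zero_of_nonempty hne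
    simp only [Nat.cast_zero] at h0
    simp [h0] at this
  rw [Measure.hausdorffMeasure_apply] at h0
  have h1 : ⨅ (t : ℕ → Set (E d)) (_ : N ⊆ ⋃ n, t n)
      (_ : ∀ n, Metric.ediam (t n) ≤ ENNReal.ofReal (ρ / 2)),
      ∑' n, ⨆ _ : (t n).Nonempty, Metric.ediam (t n) ^ (m : ℝ) = 0 := by
    have := le_iSup₂ (f := fun (r : ENNReal) (_ : 0 < r) =>
      ⨅ (t : ℕ → Set (E d)) (_ : N ⊆ ⋃ n, t n) (_ : ∀ n, Metric.ediam (t n) ≤ r),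
          ∑' n, ⨆ _ : (t n).Nonempty, Metric.ediam (t n) ^ (m : ℝ))
      (ENNReal.ofReal (ρ / 2)) (ENNReal.ofReal_pos.2 (by positivity))
    rw [h0] at this
    exact le_antisymm this bot_le
  have h2 : ⨅ (t : ℕ → Set (E d)) (_ : N ⊆ ⋃ n, t n)
      (_ : ∀ n, Metric.ediam (t n) ≤ ENNReal.ofReal (ρ / 2)),
      ∑' n, ⨆ _ : (t n).Nonempty, Metric.ediam (t n) ^ (m : ℝ) < ENNReal.ofReal (δ / 2) := by
    rw [h1]; exact ENNReal.ofReal_pos.2 (by positivity)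
  simp only [iInf_lt_iff] at h2
  obtain ⟨t, htN, htd, hts⟩ := h2
  set a : ℕ → ℝ := fun n => (Metric.ediam (t n)).toReal with ha
  have hfin : ∀ n, Metric.ediam (t n) ≠ ⊤ := fun n => ((htd n).trans_lt ENNReal.ofReal_lt_top).ne
  have haρ : ∀ n, a n ≤ ρ / 2 := fun n =>
    ENNReal.toReal_le_of_le_ofReal (by positivity) (htd n)
  have ha0 : ∀ n, 0 ≤ a n := fun n => ENNReal.toReal_nonneg
  have hsumt : ∀ s : Finset ℕ, (∀ n ∈ s, (t n).Nonempty) → ∑ n ∈ s, a n ^ m ≤ δ / 2 := by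
    intro s hs
    rw [← ENNReal.ofReal_le_ofReal_iff (by positivity),
      ENNReal.ofReal_sum_of_nonneg fun n _ => pow_nonneg (ha0 n) m]
    refine le_trans ?_ ((ENNReal.sum_le_tsum s).trans hts.le)
    refine Finset.sum_le_sum fun n hn => ?_
    rw [iSup_pos (hs n hn), ENNReal.ofReal_pow (ha0 n), ENNReal.ofReal_toReal (hfin n),
      ENNReal.rpow_natCast]
  -- enlarge the diameters slightly to get open balls
  have hr : ∀ n, ∃ r, a n < r ∧ r ≤ ρ ∧ r ^ m < a n ^ m + δ / 2 * (1 / 2) ^ (n + 1) := by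
    intro n
    have hc : ∀ᶠ r in 𝓝[>] (a n), r ^ m < a n ^ m + δ / 2 * (1 / 2) ^ (n + 1) := by
      have : ContinuousAt (fun r : ℝ => r ^ m) (a n) := by fun_prop
      exact (this.eventually_lt continuousAt_const
        (lt_add_of_pos_right _ (by positivity))).filter_mono nhdsWithin_le_nhds
    have hle : ∀ᶠ r in 𝓝[>] (a n), r ≤ ρ :=
      (eventually_le_nhds (by linarith [haρ n])).filter_mono nhdsWithin_le_nhds
    obtain ⟨r, ⟨h1, h2⟩, h3⟩ := ((hc.and hle).and self_mem_nhdsWithin).exists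
    exact ⟨r, h3, h2, h1⟩
  choose r hr1 hr2 hr3 using hr
  choose! z hz using fun n (h : (t n ∩ N).Nonempty) => h
  obtain ⟨s, hs⟩ := hN.elim_finite_subcover
    (fun n => if (t n ∩ N).Nonempty then Metric.ball (z n) (r n) else ∅)
    (fun n => by split_ifs; exacts [Metric.isOpen_ball, isOpen_empty])
    (by
      intro x hx
      obtain ⟨n, hn⟩ := mem_iUnion.1 (htN hx)
      have hne' : (t n ∩ N).Nonempty := ⟨x, hn, hx⟩
      refine mem_iUnion.2 ⟨n, ?_⟩
      rw [if_pos hne', Metric.mem_ball]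
      refine lt_of_le_of_lt ?_ (hr1 n)
      rw [dist_edist]
      exact ENNReal.toReal_mono (hfin n) (Metric.edist_le_ediam_of_mem hn (hz n hne').1))
  refine ⟨s.filter fun n => (t n ∩ N).Nonempty, z, r, ?_, ?_, ?_⟩
  · intro i hi
    exact ⟨(hz i (Finset.mem_filter.1 hi).2).2, (ha0 i).trans_lt (hr1 i), hr2 i⟩
  · intro x hx
    obtain ⟨n, hn⟩ := mem_iUnion.1 (hs hx)
    obtain ⟨hns, hn⟩ := mem_iUnion.1 hn
    by_cases h : (t n ∩ N).Nonempty
    · rw [if_pos h] at hn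
      exact mem_iUnion₂.2 ⟨n, Finset.mem_filter.2 ⟨hns, h⟩, hn⟩
    · rw [if_neg h] at hn
      exact hn.elim
  · calc ∑ i ∈ s.filter fun n => (t n ∩ N).Nonempty, r i ^ m
        ≤ ∑ i ∈ s.filter fun n => (t n ∩ N).Nonempty,
            (a i ^ m + δ / 2 * (1 / 2) ^ (i + 1)) :=
          Finset.sum_le_sum fun i _ => (hr3 i).le
      _ ≤ δ / 2 + δ / 2 * 1 := by
          rw [Finset.sum_add_distrib, ← Finset.mul_sum]
          refine add_le_add (hsumt _ fun n hn => ?_) ?_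
          · exact (Finset.mem_filter.1 hn).2.mono inter_subset_left
          · refine mul_le_mul_of_nonneg_left ?_ (by positivity)
            have hsum : HasSum (fun i : ℕ => (1 / 2 : ℝ) ^ (i + 1)) 1 := by
              have := hasSum_geometric_two.mul_left (1 / 2)
              simpa [pow_succ, mul_comm] using this
            exact sum_le_hasSum _ (fun i _ => by positivity) hsum
      _ = δ := by ring

/-- Smooth bumps at every scale `r`, equal to `1` on the ball of radius `r` and supported in the ball of
radius `2 r`, with a gradient of order `1 / r`. -/
lemma exists_scaled_bump (d : ℕ) :
    ∃ C : ℝ, 0 ≤ C ∧ ∀ z : E d, ∀ r : ℝ, 0 < r → ∃ b : E d → ℝ, ContDiff ℝ ∞ b ∧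
      (∀ x, 0 ≤ b x ∧ b x ≤ 1) ∧ (∀ x ∈ Metric.ball z r, b x = 1) ∧
      (∀ x ∉ Metric.ball z (2 * r), b x = 0) ∧
      (∀ x, ‖fderiv ℝ b x‖ ≤ (Metric.closedBall z (2 * r)).indicator (fun _ => C / r) x) := by
  let f : ContDiffBump (0 : E d) := ⟨1, 2, one_pos, one_lt_two⟩
  have hf : ContDiff ℝ ∞ f := f.contDiff
  obtain ⟨C, hC⟩ := (f.hasCompactSupport.fderiv (𝕜 := ℝ)).exists_bound_of_continuous
    (hf.continuous_fderiv (by simp))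
  refine ⟨C, (norm_nonneg _).trans (hC 0), fun z r hr => ?_⟩
  have hb0 : ∀ x ∉ Metric.ball z (2 * r), f (r⁻¹ • (x - z)) = 0 := by
    intro x hx
    apply f.zero_of_le_dist
    rw [Metric.mem_ball, not_lt, dist_eq_norm] at hx
    rw [dist_zero_right, norm_smul, norm_inv, Real.norm_of_nonneg hr.le]
    rw [inv_mul_eq_div, le_div_iff₀ hr]
    exact hx
  refine ⟨fun x => f (r⁻¹ • (x - z)), hf.comp (by fun_prop), fun x => ⟨f.nonneg, f.le_one⟩, ?_, hb0, ?_⟩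
  · intro x hx
    apply f.one_of_mem_closedBall
    rw [Metric.mem_ball, dist_eq_norm] at hx
    rw [mem_closedBall_zero_iff, norm_smul, norm_inv, Real.norm_of_nonneg hr.le]
    rw [inv_mul_eq_div, div_le_iff₀ hr, show f.rIn = 1 from rfl]
    linarith
  · intro x
    by_cases hx : x ∈ Metric.closedBall z (2 * r)
    · rw [indicator_of_mem hx]
      have h1 : HasFDerivAt (fun x => r⁻¹ • (x - z)) (r⁻¹ • ContinuousLinearMap.id ℝ (E d)) x :=
        ((hasFDerivAt_id x).sub_const z).const_smul r⁻¹
      have h2 := ((hf.differentiable (by simp)) (r⁻¹ • (x - z))).hasFDerivAt.comp x h1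
      rw [show (fun x => f (r⁻¹ • (x - z))) = f ∘ (fun x => r⁻¹ • (x - z)) from rfl, h2.fderiv]
      rw [ContinuousLinearMap.comp_smul, ContinuousLinearMap.comp_id, norm_smul, norm_inv,
        Real.norm_of_nonneg hr.le, inv_mul_eq_div]
      exact div_le_div_of_nonneg_right (hC _) hr.le
    · rw [indicator_of_notMem hx]
      have : (fun x => f (r⁻¹ • (x - z))) =ᶠ[𝓝 x] fun _ => 0 := by
        filter_upwards [Metric.isClosed_closedBall.isOpen_compl.mem_nhds hx] with y hy
        exact hb0 y fun h => hy (Metric.ball_subset_closedBall h)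
      rw [this.fderiv_eq]
      simp

/-- A compact set of vanishing `m`-dimensional Hausdorff measure is negligible for first order
calculus on `m + 1`-dimensional affine subspaces: functions can be cut off near it at the price of a
gradient which is arbitrarily small in `L¹`. -/
lemma exists_cutoff {N : Set (E d)} (hN : IsCompact N) {m : ℕ} (h0 : μH[m] N = 0)
    (μ : Measure (E d)) {C : ℝ} (hC : 0 ≤ C)
    (hμ : ∀ z : E d, ∀ r : ℝ, 0 ≤ r → μ (Metric.closedBall z r) ≤ ENNReal.ofReal (C * r ^ (m + 1)))
    {ε : ℝ} (hε : 0 < ε) :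
    ∃ η : E d → ℝ, ContDiff ℝ ∞ η ∧ (∀ x, 0 ≤ η x ∧ η x ≤ 1) ∧ Disjoint (tsupport η) N ∧
      (∀ x, (∀ z ∈ N, ε ≤ dist x z) → η x = 1) ∧
      ∫⁻ x, ‖fderiv ℝ η x‖ₑ ∂μ ≤ ENNReal.ofReal ε := by
  classical
  obtain ⟨C₁, hC₁, hbump⟩ := exists_scaled_bump d
  set D : ℝ := C₁ * (C * 2 ^ (m + 1)) with hD
  have hD0 : 0 ≤ D := by positivity
  obtain ⟨s, z, r, hzr, hcov, hsum⟩ := exists_finite_cover hN h0 (δ := ε / (D + 1)) (ρ := ε / 2)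
    (by positivity) (by positivity)
  choose! b hbs hb01 hb1 hb0 hbd using fun i (hi : i ∈ s) => hbump (z i) (r i) (hzr i hi).2.1
  have hsm : ∀ i ∈ s, ContDiff ℝ ∞ fun x => 1 - b i x := fun i hi => contDiff_const.sub (hbs i hi)
  refine ⟨fun x => ∏ i ∈ s, (1 - b i x), contDiff_prod hsm, fun x => ⟨?_, ?_⟩, ?_, ?_, ?_⟩
  · exact Finset.prod_nonneg fun i hi => by linarith [(hb01 i hi x).2]
  · exact Finset.prod_le_one (fun i hi => by linarith [(hb01 i hi x).2])
      fun i hi => by linarith [(hb01 i hi x).1]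
  · rw [Set.disjoint_right]
    intro x hx
    obtain ⟨i, hi, hxi⟩ := mem_iUnion₂.1 (hcov hx)
    rw [notMem_tsupport_iff_eventuallyEq]
    filter_upwards [Metric.isOpen_ball.mem_nhds hxi] with y hy
    exact Finset.prod_eq_zero hi (by rw [hb1 i hi y hy, sub_self])
  · intro x hx
    refine Finset.prod_eq_one fun i hi => ?_
    rw [hb0 i hi x, sub_zero]
    rw [Metric.mem_ball, not_lt]
    have := hx (z i) (hzr i hi).1
    linarith [(hzr i hi).2.2]
  · have hder : ∀ x, ‖fderiv ℝ (fun x => ∏ i ∈ s, (1 - b i x)) x‖ₑ ≤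
        ∑ i ∈ s, (Metric.closedBall (z i) (2 * r i)).indicator
          (fun _ => ENNReal.ofReal (C₁ / r i)) x := by
      intro x
      rw [fderiv_finsetProd fun i hi => (hsm i hi).differentiable (by simp) x]
      refine (enorm_sum_le s fun i =>
        (∏ j ∈ s.erase i, (1 - b j x)) • fderiv ℝ (fun x => 1 - b i x) x).trans (Finset.sum_le_sum fun i hi => ?_)
      have h1 : ‖(∏ j ∈ s.erase i, (1 - b j x)) • fderiv ℝ (fun x => 1 - b i x) x‖ ≤
          (Metric.closedBall (z i) (2 * r i)).indicator (fun _ => C₁ / r i) x := by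
        rw [norm_smul, fderiv_const_sub, norm_neg]
        refine le_trans (mul_le_of_le_one_left (norm_nonneg _) ?_) (hbd i hi x)
        rw [Real.norm_eq_abs, abs_of_nonneg]
        · exact Finset.prod_le_one
            (fun j hj => by linarith [(hb01 j (Finset.mem_of_mem_erase hj) x).2])
            fun j hj => by linarith [(hb01 j (Finset.mem_of_mem_erase hj) x).1]
        · exact Finset.prod_nonneg
            fun j hj => by linarith [(hb01 j (Finset.mem_of_mem_erase hj) x).2]
      rw [← ofReal_norm]
      refine (ENNReal.ofReal_le_ofReal h1).trans_eq ?_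
      by_cases hx : x ∈ Metric.closedBall (z i) (2 * r i) <;> simp [hx]
    calc ∫⁻ x, ‖fderiv ℝ (fun x => ∏ i ∈ s, (1 - b i x)) x‖ₑ ∂μ
        ≤ ∫⁻ x, ∑ i ∈ s, (Metric.closedBall (z i) (2 * r i)).indicator
          (fun _ => ENNReal.ofReal (C₁ / r i)) x ∂μ := lintegral_mono hder
      _ = ∑ i ∈ s, ENNReal.ofReal (C₁ / r i) * μ (Metric.closedBall (z i) (2 * r i)) := by
          rw [lintegral_finsetSum _ fun i _ =>
            measurable_const.indicator Metric.isClosed_closedBall.measurableSet]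
          refine Finset.sum_congr rfl fun i _ => ?_
          rw [lintegral_indicator_const Metric.isClosed_closedBall.measurableSet]
      _ ≤ ∑ i ∈ s, ENNReal.ofReal (D * r i ^ m) := by
          refine Finset.sum_le_sum fun i hi => ?_
          have hri := (hzr i hi).2.1
          refine (mul_le_mul_right (hμ (z i) (2 * r i) (by positivity)) _).trans_eq ?_
          rw [← ENNReal.ofReal_mul (by positivity)]
          congr 1
          rw [hD]
          field_simp
          ring
      _ = ENNReal.ofReal (D * ∑ i ∈ s, r i ^ m) := by
          rw [Finset.mul_sum, ENNReal.ofReal_sum_of_nonneg]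
          intro i hi
          have hri := (hzr i hi).2.1
          positivity
      _ ≤ ENNReal.ofReal ε := by
          apply ENNReal.ofReal_le_ofReal
          calc D * ∑ i ∈ s, r i ^ m ≤ D * (ε / (D + 1)) := by gcongr
            _ ≤ (D + 1) * (ε / (D + 1)) := by gcongr; linarith
            _ = ε := by field_simp

end Cutoff

/-! ### Concentration of thin layers on a hyperplane -/

section Layer
variable {d : ℕ}

/-- The linear isometry of `ℝ^m` onto the coordinate hyperplane of `ℝ^(m+1)` where the coordinate of
index `0` vanishes. -/
def hyperplaneEmb (m : ℕ) (z : E m) : E (m + 1) := WithLp.toLp 2 (Fin.cons 0 z.ofLp)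

lemma isometry_hyperplaneEmb (m : ℕ) : Isometry (hyperplaneEmb m) := by
  refine Isometry.of_dist_eq fun z w => ?_
  rw [EuclideanSpace.dist_eq, EuclideanSpace.dist_eq, Fin.sum_univ_succ]
  simp [hyperplaneEmb]

lemma isClosed_setOf_sub_mem (V : Submodule ℝ (E d)) (x : E d) : IsClosed {y | y - x ∈ V} :=
  (Submodule.closed_of_finiteDimensional V).preimage (continuous_id.sub continuous_const)

/-- The functions `y ↦ δ⁻¹ κ(δ⁻¹ ⟪n, y - x⟫)` on the affine subspace `x + V` concentrate on the
hyperplane through `x` orthogonal to `n` when `δ → 0`. -/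
lemma tendsto_integral_layer {m : ℕ} {V : Submodule ℝ (E d)} (hV : finrank ℝ V = m + 1) {n : E d}
    (hnV : n ∈ V) (hn : ‖n‖ = 1) (x : E d) {F : E d → E d} (hF : Continuous F)
    (hFc : HasCompactSupport F) {κ : ℝ → ℝ} (hκ : Continuous κ) (hκc : HasCompactSupport κ) :
    Tendsto (fun δ : ℝ => ∫ y in {y | y - x ∈ V}, (δ⁻¹ * κ (δ⁻¹ * ⟪n, y - x⟫)) • F y ∂μHE[m + 1])
      (𝓝[>] 0)
      (𝓝 ((∫ s, κ s) • ∫ y in {y | y - x ∈ V ∧ ⟪n, y - x⟫ = 0}, F y ∂μHE[m])) := by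
  -- an orthonormal basis of `V` whose first vector is `n`
  obtain ⟨b, hb⟩ : ∃ b : OrthonormalBasis (Fin (m + 1)) ℝ V, (b 0 : E d) = n := by
    have ho : Orthonormal ℝ (({0} : Set (Fin (m + 1))).domRestrict fun _ => (⟨n, hnV⟩ : V)) := by
      refine ⟨fun i => by simpa using hn, fun i j hij => (hij (Subsingleton.elim _ _)).elim⟩
    obtain ⟨b, hb⟩ := ho.exists_orthonormalBasis_extension_of_card_eq (by simpa using hV)
    exact ⟨b, by rw [hb 0 rfl]⟩
  have hnc : ∀ c : E (m + 1), ⟪n, chart b x c - x⟫ = c 0 := by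
    intro c
    have h1 : ⟪(b 0 : E d), ((b.repr.symm c : V) : E d)⟫ = c 0 := by
      rw [← Submodule.coe_inner, ← b.repr_apply_apply]
      simp
    rw [← hb, ← h1]
    simp [chart]
  -- the coordinates `(t, z)`, with `t` along `n`
  let e : ℝ × (Fin m → ℝ) → E (m + 1) := fun p => WithLp.toLp 2 (Fin.cons p.1 p.2)
  have hemp : MeasurePreserving e volume volume := by
    have h1 := (volume_preserving_piFinSuccAbove (fun _ : Fin (m + 1) => ℝ) 0).symm
    have h2 := (PiLp.volume_preserving_toLp (Fin (m + 1))).comp h1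
    have he : e = WithLp.toLp 2 ∘ (MeasurableEquiv.piFinSuccAbove (fun _ => ℝ) 0).symm := by
      funext p
      simp [e, MeasurableEquiv.piFinSuccAbove, Fin.insertNthEquiv]
    rw [he]
    exact h2
  have hecont : Continuous e := by
    refine (PiLp.continuous_toLp 2 _).comp (continuous_pi fun i => ?_)
    refine Fin.cases ?_ (fun j => ?_) i
    · simpa using continuous_fst
    · exact (continuous_apply j).comp continuous_snd
  let e' : E (m + 1) → ℝ × (Fin m → ℝ) := fun c => (c 0, fun j => c j.succ)
  have he'cont : Continuous e' := by
    refine (by fun_prop : Continuous fun c : E (m + 1) => c 0).prodMk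
      (continuous_pi fun j => by fun_prop)
  have hee' : ∀ c, e (e' c) = c := by
    intro c
    ext i
    refine Fin.cases ?_ (fun j => ?_) i <;> simp [e, e']
  have he'e : ∀ p, e' (e p) = p := by
    intro p
    simp [e, e']
  let eh : ℝ × (Fin m → ℝ) ≃ₜ E (m + 1) := ⟨⟨e, e', he'e, hee'⟩, hecont, he'cont⟩
  let Φ : ℝ × (Fin m → ℝ) → E d := fun p => chart b x (e p)
  have hΦ : IsClosedEmbedding Φ := (isometry_chart b x).isClosedEmbedding.comp eh.isClosedEmbedding
  have hnΦ : ∀ p, ⟪n, Φ p - x⟫ = p.1 := fun p => by simp [Φ, hnc, e]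
  have hint : ∀ f : E d → E d, ∫ y in {y | y - x ∈ V}, f y ∂μHE[m + 1] = ∫ p, f (Φ p) := by
    intro f
    rw [← map_chart b x, (measurableEmbedding_chart b x).integral_map,
      ← hemp.integral_comp eh.measurableEmbedding]
  have hint0 : ∫ y in {y | y - x ∈ V ∧ ⟪n, y - x⟫ = 0}, F y ∂μHE[m] =
      ∫ z : Fin m → ℝ, F (Φ (0, z)) := by
    have hiso := (isometry_chart b x).comp (isometry_hyperplaneEmb m)
    have hr : range (chart b x ∘ hyperplaneEmb m) = {y | y - x ∈ V ∧ ⟪n, y - x⟫ = 0} := by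
      ext y
      constructor
      · rintro ⟨z, rfl⟩
        refine ⟨?_, by simp [hnc, hyperplaneEmb]⟩
        have : chart b x (hyperplaneEmb m z) ∈ range (chart b x) := mem_range_self _
        rwa [range_chart] at this
      · rintro ⟨h1, h2⟩
        have h1' : y ∈ range (chart b x) := by rw [range_chart]; exact h1
        obtain ⟨c, rfl⟩ := h1'
        rw [hnc] at h2
        refine ⟨WithLp.toLp 2 fun j => c j.succ, ?_⟩
        simp only [Function.comp]
        congr 1
        ext i
        refine Fin.cases ?_ (fun j => ?_) i <;> simp [hyperplaneEmb, h2]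
    rw [← hr, ← hiso.map_euclideanHausdorffMeasure,
      hiso.isClosedEmbedding.measurableEmbedding.integral_map,
      EuclideanSpace.euclideanHausdorffMeasure_eq_volume,
      ← (PiLp.volume_preserving_toLp (Fin m)).integral_comp
        (MeasurableEquiv.toLp 2 _).measurableEmbedding]
    rfl
  have hFΦ : Continuous fun p => F (Φ p) := hF.comp hΦ.continuous
  have hFΦc : HasCompactSupport fun p => F (Φ p) := hFc.comp_isClosedEmbedding hΦ
  let g : ℝ → E d := fun t => ∫ z : Fin m → ℝ, F (Φ (t, z))
  have hg : Continuous g := by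
    rw [← continuousOn_univ]
    refine continuousOn_integral_of_compact_support
      (k := Prod.snd '' tsupport fun p => F (Φ p)) (IsCompact.image hFΦc continuous_snd)
      hFΦ.continuousOn ?_
    intro t z _ hz
    by_contra h
    exact hz ⟨(t, z), subset_tsupport _ h, rfl⟩
  -- the integral over the layer, after rescaling of the normal variable
  let u : ℝ → E d := fun δ => ∫ s, κ s • g (δ * s)
  have hu : Continuous u := by
    rw [← continuousOn_univ]
    refine continuousOn_integral_of_compact_support (k := tsupport κ) hκc
      (Continuous.continuousOn ?_) ?_
    · exact (hκ.comp continuous_snd).smul (hg.comp (continuous_fst.mul continuous_snd))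
    · intro δ s _ hs
      simp [image_eq_zero_of_notMem_tsupport hs]
  have hu0 : u 0 = (∫ s, κ s) • ∫ y in {y | y - x ∈ V ∧ ⟪n, y - x⟫ = 0}, F y ∂μHE[m] := by
    rw [hint0]
    simp only [u, zero_mul]
    rw [integral_smul_const]
  rw [← hu0]
  refine (hu.tendsto 0 |>.mono_left nhdsWithin_le_nhds).congr' ?_
  filter_upwards [self_mem_nhdsWithin] with δ hδ
  have hδ0 : (0 : ℝ) < δ := hδ
  rw [hint]
  simp_rw [hnΦ]
  rw [Measure.volume_eq_prod, integral_prod]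
  · simp_rw [integral_smul]
    have h := Measure.integral_comp_mul_left (fun t => κ (δ⁻¹ * t) • g t) δ
    simp only [u]
    simp_rw [inv_mul_cancel_left₀ hδ0.ne'] at h
    rw [h, abs_of_pos (inv_pos.2 hδ0), ← integral_smul]
    simp_rw [mul_smul]
    rfl
  · refine Continuous.integrable_of_hasCompactSupport ?_ ?_
    · exact (continuous_const.mul (hκ.comp (continuous_const.mul continuous_fst))).smul hFΦ
    · exact HasCompactSupport.smul_left (f := fun p : ℝ × (Fin m → ℝ) => δ⁻¹ * κ (δ⁻¹ * p.1)) hFΦc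

end Layer

/-! ### Flat pieces with a piecewise flat boundary -/

section FlatPiece
variable {d : ℕ}

/-- `A` is a bounded, relatively open subset of an affine subspace of dimension `m + 1`, and its
relative boundary is made of the flat pieces `B ∈ S`, near which `A` lies on one side and is bounded
only by `B`, with outward normal `n B`, and of a negligible compact set `N`, which contains the
relative boundaries of the pieces. -/
structure IsFlatPiece (m : ℕ) (A : Set (E d)) (S : Finset (Set (E d))) (n : Set (E d) → E d)
    (N : Set (E d)) : Prop where
  isBounded : Bornology.IsBounded A
  finrank_eq : finrank ℝ (vectorSpan ℝ A) = m + 1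
  relOpen : ∃ U : Set (E d), IsOpen U ∧ A = U ∩ affineSpan ℝ A
  boundary_eq : closure A \ A = (⋃ B ∈ S, B) ∪ N
  pairwiseDisjoint : (S : Set (Set (E d))).PairwiseDisjoint id
  disjoint_null : ∀ B ∈ S, Disjoint B N
  closure_subset : ∀ B ∈ S, closure B ⊆ B ∪ N
  isOutwardNormal : ∀ B ∈ S, IsOutwardNormal A B (n B)
  isCompact_null : IsCompact N
  measure_null : μH[m] N = 0
  measure_lt_top : ∀ B ∈ S, μHE[m] B < ⊤

lemma coe_affineSpan_eq {A : Set (E d)} {x : E d} (hx : x ∈ affineSpan ℝ A) :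
    (affineSpan ℝ A : Set (E d)) = {y | y - x ∈ vectorSpan ℝ A} := by
  ext y
  rw [SetLike.mem_coe, mem_ofPred_eq, ← direction_affineSpan, ← vsub_eq_sub,
    AffineSubspace.vsub_right_mem_direction_iff_mem hx]

lemma closure_subset_affineSpan (A : Set (E d)) : closure A ⊆ affineSpan ℝ A :=
  closure_minimal (subset_affineSpan ℝ A) (AffineSubspace.closed_of_finiteDimensional _)

lemma integrableOn_of_continuousOn {B : Set (E d)} (hB : Bornology.IsBounded B)
    (hBm : MeasurableSet B) {μ : Measure (E d)} (hμ : μ B < ⊤) {f : E d → E d}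
    (hf : ContinuousOn f (closure B)) : IntegrableOn f B μ := by
  obtain ⟨C, hC⟩ := hB.isCompact_closure.exists_bound_of_continuousOn hf
  exact IntegrableOn.of_bound hμ ((hf.mono subset_closure).aestronglyMeasurable hBm) C
    (ae_restrict_of_forall_mem hBm fun x hx => hC x (subset_closure hx))

namespace IsFlatPiece

variable {m : ℕ} {A : Set (E d)} {S : Finset (Set (E d))} {n : Set (E d) → E d}
  {N : Set (E d)}

lemma measurableSet (h : IsFlatPiece m A S n N) : MeasurableSet A := by
  obtain ⟨U, hU, hA⟩ := h.relOpen
  rw [hA]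
  exact hU.measurableSet.inter (AffineSubspace.closed_of_finiteDimensional _).measurableSet

lemma nonempty (h : IsFlatPiece m A S n N) : A.Nonempty := by
  by_contra hne
  have := h.finrank_eq
  rw [not_nonempty_iff_eq_empty.1 hne, vectorSpan_empty, finrank_bot] at this
  omega

lemma measure_lt_top' (h : IsFlatPiece m A S n N) : μHE[m + 1] A < ⊤ :=
  measure_lt_top_of_isBounded h.isBounded h.finrank_eq

lemma measure_pos (h : IsFlatPiece m A S n N) : 0 < μHE[m + 1] A := by
  obtain ⟨x, hx⟩ := h.nonempty
  obtain ⟨U, hU, hA⟩ := h.relOpen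
  let b : OrthonormalBasis (Fin (m + 1)) ℝ (vectorSpan ℝ A) :=
    (stdOrthonormalBasis ℝ _).reindex (finCongr h.finrank_eq)
  have hxU : x ∈ U := (hA ▸ hx : x ∈ U ∩ affineSpan ℝ A).1
  rw [hA, coe_affineSpan_eq (subset_affineSpan ℝ A hx),
    ← Measure.restrict_apply hU.measurableSet, ← map_chart b x,
    (measurableEmbedding_chart b x).map_apply]
  exact (hU.preimage (isometry_chart b x).continuous).measure_pos volume ⟨0, by simpa [chart]⟩

lemma subset_boundary (h : IsFlatPiece m A S n N) {B : Set (E d)} (hB : B ∈ S) :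
    B ⊆ closure A \ A := by
  rw [h.boundary_eq]
  exact (subset_biUnion_of_mem (u := id) hB).trans subset_union_left

lemma measurableSet_of_mem (h : IsFlatPiece m A S n N) {B : Set (E d)} (hB : B ∈ S) :
    MeasurableSet B := by
  have : B = closure B \ N := by
    ext x
    exact ⟨fun hx => ⟨subset_closure hx, disjoint_left.1 (h.disjoint_null B hB) hx⟩,
      fun hx => (h.closure_subset B hB hx.1).resolve_right hx.2⟩
  rw [this]
  exact isClosed_closure.measurableSet.diff h.isCompact_null.measurableSet

lemma isBounded_of_mem (h : IsFlatPiece m A S n N) {B : Set (E d)} (hB : B ∈ S) :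
    Bornology.IsBounded B :=
  h.isBounded.closure.subset ((h.subset_boundary hB).trans sdiff_subset)

/-- Near a point of a boundary piece `B`, the set `A` is a half-space of its affine span, `B` is the
bounding hyperplane, and there is no other boundary piece. -/
lemma exists_ball (h : IsFlatPiece m A S n N) {B : Set (E d)} (hB : B ∈ S) {x : E d}
    (hx : x ∈ B) : ∃ r > 0,
      (∀ y ∈ Metric.ball x r, y ∈ A ↔ y - x ∈ vectorSpan ℝ A ∧ ⟪n B, y - x⟫ < 0) ∧
      (∀ y ∈ Metric.ball x r, y ∈ B ↔ y - x ∈ vectorSpan ℝ A ∧ ⟪n B, y - x⟫ = 0) ∧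
      ∀ B' ∈ S, B' ≠ B → Disjoint B' (Metric.ball x r) := by
  classical
  have hn := h.isOutwardNormal B hB
  have hxspan : x ∈ affineSpan ℝ A :=
    closure_subset_affineSpan A (h.subset_boundary hB hx).1
  have hspan : ∀ y, y ∈ affineSpan ℝ A ↔ y - x ∈ vectorSpan ℝ A := fun y => by
    rw [← SetLike.mem_coe, coe_affineSpan_eq hxspan]; rfl
  obtain ⟨r₁, hr₁, hAr⟩ := hn.oneSided x hx
  set T : Set (E d) := N ∪ ⋃ B' ∈ S.erase B, closure B' with hT
  have hTc : IsClosed T := h.isCompact_null.isClosed.union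
    (isClosed_biUnion_finset fun _ _ => isClosed_closure)
  have hdisj : ∀ B' ∈ S, B' ≠ B → x ∉ B' := fun B' hB' hne hx' =>
    disjoint_left.1 (h.pairwiseDisjoint hB' hB hne) hx' hx
  have hxN : x ∉ N := disjoint_left.1 (h.disjoint_null B hB) hx
  have hxT : x ∉ T := by
    rintro (hxN' | hx')
    · exact hxN hxN'
    · obtain ⟨B', hB', hxB'⟩ := mem_iUnion₂.1 hx'
      rw [Finset.mem_erase] at hB'
      rcases h.closure_subset B' hB'.2 hxB' with h1 | h1
      · exact hdisj B' hB'.2 hB'.1 h1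
      · exact hxN h1
  obtain ⟨r₂, hr₂, hTr⟩ := Metric.isOpen_iff.1 hTc.isOpen_compl x hxT
  have hA : ∀ y ∈ Metric.ball x (min r₁ r₂),
      y ∈ A ↔ y - x ∈ vectorSpan ℝ A ∧ ⟪n B, y - x⟫ < 0 := by
    intro y hy
    have hy₁ : y ∈ Metric.ball x r₁ := Metric.ball_subset_ball (min_le_left _ _) hy
    have := Set.ext_iff.1 hAr y
    simp only [mem_inter_iff, hy₁, and_true, mem_ofPred_eq, true_and] at this
    rw [this, hspan]
  have hcont : Continuous fun y => ⟪n B, y - x⟫ := by fun_prop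
  refine ⟨min r₁ r₂, lt_min hr₁ hr₂, hA, fun y hy => ⟨fun hyB => ?_, fun hyB => ?_⟩, ?_⟩
  · have hyA := h.subset_boundary hB hyB
    have hyV := (hspan y).1 (closure_subset_affineSpan A hyA.1)
    refine ⟨hyV, le_antisymm ?_ ?_⟩
    · by_contra hpos
      obtain ⟨z, ⟨hz1, hz2⟩, hzA⟩ := mem_closure_iff.1 hyA.1
        (Metric.ball x (min r₁ r₂) ∩ {z | 0 < ⟪n B, z - x⟫})
        (Metric.isOpen_ball.inter (isOpen_lt continuous_const hcont)) ⟨hy, not_le.1 hpos⟩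
      exact absurd ((hA z hz1).1 hzA).2 (not_lt.2 hz2.le)
    · by_contra hneg
      exact hyA.2 ((hA y hy).2 ⟨hyV, not_le.1 hneg⟩)
  · have hyA : y ∉ A := fun hyA => by
      have := ((hA y hy).1 hyA).2
      rw [hyB.2] at this
      exact lt_irrefl _ this
    have hycl : y ∈ closure A := by
      -- `y` is the limit of the points `y - t n` of `A`
      have ht : Tendsto (fun t : ℝ => y - t • n B) (𝓝[>] 0) (𝓝 y) := by
        have : Continuous fun t : ℝ => y - t • n B := by fun_prop
        simpa using (this.tendsto 0).mono_left (nhdsWithin_le_nhds (s := Ioi 0))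
      refine mem_closure_of_tendsto ht ?_
      filter_upwards [ht (Metric.isOpen_ball.mem_nhds hy), self_mem_nhdsWithin] with t hty ht0
      refine (hA _ hty).2 ⟨?_, ?_⟩
      · rw [sub_right_comm]
        exact Submodule.sub_mem _ hyB.1 (Submodule.smul_mem _ _ hn.tangent)
      · rw [sub_right_comm, inner_sub_right, hyB.2, inner_smul_right,
          real_inner_self_eq_norm_sq, hn.norm_eq]
        have : (0 : ℝ) < t := ht0
        linarith
    have hyb : y ∈ (⋃ B ∈ S, B) ∪ N := h.boundary_eq ▸ ⟨hycl, hyA⟩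
    have hyT : y ∉ T := hTr (Metric.ball_subset_ball (min_le_right _ _) hy)
    rcases hyb with hyb | hyN
    · obtain ⟨B', hB', hyB'⟩ := mem_iUnion₂.1 hyb
      by_contra hyn
      refine hyT (Or.inr (mem_iUnion₂.2 ⟨B', Finset.mem_erase.2 ⟨?_, hB'⟩, subset_closure hyB'⟩))
      rintro rfl
      exact hyn hyB'
    · exact (hyT (Or.inl hyN)).elim
  · intro B' hB' hne
    rw [disjoint_left]
    intro y hyB' hy
    exact hTr (Metric.ball_subset_ball (min_le_right _ _) hy)
      (Or.inr (mem_iUnion₂.2 ⟨B', Finset.mem_erase.2 ⟨hne, hB'⟩, subset_closure hyB'⟩))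

end IsFlatPiece
end FlatPiece

/-! ### A smooth step function -/

/-- A smooth step: `1` on `(-∞, -2]` and `0` on `[-1, ∞)`. -/
def smoothStep (s : ℝ) : ℝ := Real.smoothTransition (-1 - s)

lemma contDiff_smoothStep : ContDiff ℝ ∞ smoothStep :=
  Real.smoothTransition.contDiff.comp (by fun_prop)

lemma smoothStep_of_le {s : ℝ} (hs : s ≤ -2) : smoothStep s = 1 :=
  Real.smoothTransition.one_of_one_le (by linarith)

lemma smoothStep_of_ge {s : ℝ} (hs : -1 ≤ s) : smoothStep s = 0 :=
  Real.smoothTransition.zero_of_nonpos (by linarith)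

lemma abs_smoothStep_le (s : ℝ) : |smoothStep s| ≤ 1 := by
  rw [smoothStep, abs_of_nonneg (Real.smoothTransition.nonneg _)]
  exact Real.smoothTransition.le_one _

lemma hasDerivAt_smoothStep (s : ℝ) : HasDerivAt smoothStep (deriv smoothStep s) s :=
  (contDiff_smoothStep.differentiable (by simp) s).hasDerivAt

lemma continuous_deriv_smoothStep : Continuous (deriv smoothStep) :=
  contDiff_smoothStep.continuous_deriv (by simp)

lemma deriv_smoothStep_of_gt {s : ℝ} (hs : -1 < s) : deriv smoothStep s = 0 := by
  have : smoothStep =ᶠ[𝓝 s] fun _ => 0 := by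
    filter_upwards [Ioi_mem_nhds hs] with t ht
    exact smoothStep_of_ge (le_of_lt ht)
  rw [this.deriv_eq, deriv_const]

lemma deriv_smoothStep_of_lt {s : ℝ} (hs : s < -2) : deriv smoothStep s = 0 := by
  have : smoothStep =ᶠ[𝓝 s] fun _ => 1 := by
    filter_upwards [Iio_mem_nhds hs] with t ht
    exact smoothStep_of_le (le_of_lt ht)
  rw [this.deriv_eq, deriv_const]

lemma hasCompactSupport_deriv_smoothStep : HasCompactSupport (deriv smoothStep) := by
  refine HasCompactSupport.of_support_subset_isCompact (isCompact_Icc (a := -2) (b := -1)) ?_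
  intro s hs
  by_contra h
  rw [mem_Icc, not_and_or, not_le, not_le] at h
  rcases h with h | h
  · exact hs (deriv_smoothStep_of_lt h)
  · exact hs (deriv_smoothStep_of_gt h)

lemma integral_deriv_smoothStep : ∫ s, deriv smoothStep s = -1 := by
  have h1 : Tendsto smoothStep atBot (𝓝 1) :=
    tendsto_const_nhds.congr' ((eventually_le_atBot (-2)).mono fun s hs => (smoothStep_of_le hs).symm)
  have h2 : Tendsto smoothStep atTop (𝓝 0) :=
    tendsto_const_nhds.congr' ((eventually_ge_atTop (-1)).mono fun s hs => (smoothStep_of_ge hs).symm)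
  rw [integral_of_hasDerivAt_of_tendsto hasDerivAt_smoothStep
    (continuous_deriv_smoothStep.integrable_of_hasCompactSupport
      hasCompactSupport_deriv_smoothStep) h1 h2]
  norm_num

/-! ### Green's formula on flat pieces -/

section Green
variable {d : ℕ}

/-- Green's formula in the direction `τ`, tested with the function `φ`, for a function `v` with weak
gradient `G` on the flat piece `A`. -/
def GreenFormula (m : ℕ) (A : Set (E d)) (S : Finset (Set (E d))) (n : Set (E d) → E d)
    (v : E d → E d) (G : E d → E d →L[ℝ] E d) (τ : E d) (φ : E d → ℝ) : Prop :=
  ∫ x in A, (φ x • G x τ + fderiv ℝ φ x τ • v x) ∂μHE[m + 1] =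
    ∑ B ∈ S, ⟪n B, τ⟫ • ∫ x in B, φ x • v x ∂μHE[m]

variable {m : ℕ} {A : Set (E d)} {S : Finset (Set (E d))} {n : Set (E d) → E d}
  {N : Set (E d)} {v : E d → E d} {G : E d → E d →L[ℝ] E d}

lemma continuous_fderiv_apply {φ : E d → ℝ} (hφ : ContDiff ℝ ∞ φ) (τ : E d) :
    Continuous fun x => fderiv ℝ φ x τ :=
  (hφ.continuous_fderiv (by simp)).clm_apply continuous_const

lemma IsFlatPiece.integrableOn_weakGrad (h : IsFlatPiece m A S n N)
    (hG : HasWeakGrad A μHE[m + 1] v G) : IntegrableOn G A μHE[m + 1] := by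
  have : IsFiniteMeasure ((μHE[m + 1] : Measure (E d)).restrict A) :=
    ⟨by rw [Measure.restrict_apply_univ]; exact h.measure_lt_top'⟩
  exact hG.memLp.integrable one_le_two

lemma IsFlatPiece.integrableOn_smul_weakGrad (h : IsFlatPiece m A S n N)
    (hG : HasWeakGrad A μHE[m + 1] v G) {φ : E d → ℝ} (hφ : Continuous φ) (τ : E d) :
    IntegrableOn (fun x => φ x • G x τ) A μHE[m + 1] := by
  have h1 : IntegrableOn (fun x => G x τ) A μHE[m + 1] :=
    (h.integrableOn_weakGrad hG).apply_continuousLinearMap τ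
  obtain ⟨C, hC⟩ := h.isBounded.isCompact_closure.exists_bound_of_continuousOn hφ.continuousOn
  exact Integrable.bdd_smul h1 C hφ.aestronglyMeasurable
    (ae_restrict_of_forall_mem h.measurableSet fun x hx => hC x (subset_closure hx))

lemma IsFlatPiece.integrableOn_of_continuous (h : IsFlatPiece m A S n N) {f : E d → E d}
    (hf : Continuous f) : IntegrableOn f A μHE[m + 1] :=
  integrableOn_of_continuousOn h.isBounded h.measurableSet h.measure_lt_top' hf.continuousOn

lemma IsFlatPiece.integrableOn_mem_of_continuous (h : IsFlatPiece m A S n N) {B : Set (E d)}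
    (hB : B ∈ S) {f : E d → E d} (hf : Continuous f) : IntegrableOn f B μHE[m] :=
  integrableOn_of_continuousOn (h.isBounded_of_mem hB) (h.measurableSet_of_mem hB)
    (h.measure_lt_top B hB) hf.continuousOn

lemma IsFlatPiece.integrableOn_green (h : IsFlatPiece m A S n N)
    (hG : HasWeakGrad A μHE[m + 1] v G) (hv : Continuous v) {φ : E d → ℝ} (hφ : ContDiff ℝ ∞ φ)
    (τ : E d) :
    IntegrableOn (fun x => φ x • G x τ + fderiv ℝ φ x τ • v x) A μHE[m + 1] :=
  (h.integrableOn_smul_weakGrad hG hφ.continuous τ).add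
    (h.integrableOn_of_continuous ((continuous_fderiv_apply hφ τ).smul hv))

/-- Away from the relative boundary, Green's formula is the definition of the weak gradient. -/
lemma IsFlatPiece.greenFormula_of_isTestFunction (h : IsFlatPiece m A S n N)
    (hG : HasWeakGrad A μHE[m + 1] v G) (hv : Continuous v) {φ : E d → ℝ}
    (hφ : IsTestFunction A φ) {τ : E d} (hτ : τ ∈ vectorSpan ℝ A) :
    GreenFormula m A S n v G τ φ := by
  have h0 : ∀ B ∈ S, ∫ x in B, φ x • v x ∂μHE[m] = 0 := fun B hB => by
    refine setIntegral_eq_zero_of_forall_eq_zero fun x hx => ?_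
    have hxA := h.subset_boundary hB hx
    rw [image_eq_zero_of_notMem_tsupport fun hx' => hxA.2 (hφ.support ⟨hx', hxA.1⟩), zero_smul]
  have hint : IntegrableOn (fun x => fderiv ℝ φ x τ • v x) A μHE[m + 1] :=
    h.integrableOn_of_continuous ((continuous_fderiv_apply hφ.smooth τ).smul hv)
  rw [GreenFormula,
    integral_add (h.integrableOn_smul_weakGrad hG hφ.smooth.continuous τ) hint,
    hG.integral_eq φ hφ τ hτ, add_neg_cancel]
  exact (Finset.sum_eq_zero fun B hB => by rw [h0 B hB, smul_zero]).symm

lemma IsFlatPiece.greenFormula_sum (h : IsFlatPiece m A S n N)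
    (hG : HasWeakGrad A μHE[m + 1] v G) (hv : Continuous v) {ι : Type*} (s : Finset ι)
    {φ : ι → E d → ℝ} (hφ : ∀ i ∈ s, ContDiff ℝ ∞ (φ i)) {τ : E d}
    (hg : ∀ i ∈ s, GreenFormula m A S n v G τ (φ i)) :
    GreenFormula m A S n v G τ fun x => ∑ i ∈ s, φ i x := by
  have h1 : ∀ x, (∑ i ∈ s, φ i x) • G x τ + fderiv ℝ (fun x => ∑ i ∈ s, φ i x) x τ • v x =
      ∑ i ∈ s, (φ i x • G x τ + fderiv ℝ (φ i) x τ • v x) := by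
    intro x
    rw [fderiv_fun_sum fun i hi => (hφ i hi).differentiable (by simp) x,
      sum_apply, Finset.sum_smul, Finset.sum_smul, Finset.sum_add_distrib]
  have h2 : ∀ B ∈ S, ∫ x in B, (∑ i ∈ s, φ i x) • v x ∂μHE[m] =
      ∑ i ∈ s, ∫ x in B, φ i x • v x ∂μHE[m] := by
    intro B hB
    simp_rw [Finset.sum_smul]
    exact integral_finsetSum s fun i hi =>
      h.integrableOn_mem_of_continuous hB ((hφ i hi).continuous.smul hv)
  rw [GreenFormula]
  simp_rw [h1]
  rw [integral_finsetSum s fun i hi => h.integrableOn_green hG hv (hφ i hi) τ,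
    Finset.sum_congr rfl hg, Finset.sum_comm]
  refine Finset.sum_congr rfl fun B hB => ?_
  rw [h2 B hB, Finset.smul_sum]

/-- Green's formula for a test function supported near a point of a boundary piece. The test function
is multiplied by a cut-off depending on the distance to the hyperplane containing the piece; the
gradient of the cut-off concentrates on that hyperplane. -/
lemma IsFlatPiece.greenFormula_of_ball (h : IsFlatPiece m A S n N)
    (hG : HasWeakGrad A μHE[m + 1] v G) (hv : Continuous v) {B : Set (E d)} (hB : B ∈ S)
    {x : E d} (hx : x ∈ B) {τ : E d} (hτ : τ ∈ vectorSpan ℝ A) {r : ℝ}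
    (hrA : ∀ y ∈ Metric.ball x r, y ∈ A ↔ y - x ∈ vectorSpan ℝ A ∧ ⟪n B, y - x⟫ < 0)
    (hrB : ∀ y ∈ Metric.ball x r, y ∈ B ↔ y - x ∈ vectorSpan ℝ A ∧ ⟪n B, y - x⟫ = 0)
    (hrS : ∀ B' ∈ S, B' ≠ B → Disjoint B' (Metric.ball x r))
    {φ : E d → ℝ} (hφ : ContDiff ℝ ∞ φ) (hφc : HasCompactSupport φ)
    (hφr : tsupport φ ⊆ Metric.ball x r) : GreenFormula m A S n v G τ φ := by
  classical
  have hn := h.isOutwardNormal B hB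
  have hφ0 : ∀ y ∉ Metric.ball x r, φ y = 0 := fun y hy =>
    image_eq_zero_of_notMem_tsupport fun hy' => hy (hφr hy')
  have hφ0' : ∀ y ∉ Metric.ball x r, fderiv ℝ φ y = 0 := fun y hy =>
    image_eq_zero_of_notMem_tsupport fun hy' => hy (hφr (tsupport_fderiv_subset ℝ hy'))
  have hxspan : x ∈ affineSpan ℝ A :=
    closure_subset_affineSpan A (h.subset_boundary hB hx).1
  have hAV : closure A ⊆ {y | y - x ∈ vectorSpan ℝ A} := by
    rw [← coe_affineSpan_eq hxspan]
    exact closure_subset_affineSpan A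
  -- the boundary term
  have hbd : ∑ B' ∈ S, ⟪n B', τ⟫ • ∫ y in B', φ y • v y ∂μHE[m] =
      ⟪n B, τ⟫ • ∫ y in {y | y - x ∈ vectorSpan ℝ A ∧ ⟪n B, y - x⟫ = 0}, φ y • v y ∂μHE[m] := by
    have hHm : MeasurableSet {y | y - x ∈ vectorSpan ℝ A ∧ ⟪n B, y - x⟫ = 0} :=
      ((isClosed_setOf_sub_mem (vectorSpan ℝ A) x).inter (isClosed_eq
        (by fun_prop : Continuous fun y => ⟪n B, y - x⟫) continuous_const)).measurableSet
    have hH : ∀ y, y ∈ {y | y - x ∈ vectorSpan ℝ A ∧ ⟪n B, y - x⟫ = 0} ↔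
        y - x ∈ vectorSpan ℝ A ∧ ⟪n B, y - x⟫ = 0 := fun y => Iff.rfl
    rw [Finset.sum_eq_single_of_mem B hB]
    · congr 1
      rw [← integral_indicator (h.measurableSet_of_mem hB), ← integral_indicator hHm]
      congr 1
      funext y
      by_cases hy : y ∈ Metric.ball x r
      · by_cases hyB : y ∈ B
        · rw [indicator_of_mem hyB, indicator_of_mem ((hH y).2 ((hrB y hy).1 hyB))]
        · rw [indicator_of_notMem hyB, indicator_of_notMem fun hyH => hyB ((hrB y hy).2 ((hH y).1 hyH))]
      · simp [indicator, hφ0 y hy]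
    · intro B' hB' hne
      rw [setIntegral_eq_zero_of_forall_eq_zero, smul_zero]
      intro y hy
      rw [hφ0 y fun hy' => disjoint_left.1 (hrS B' hB' hne) hy hy', zero_smul]
  -- the cut-off test function
  have hℓ : ∀ (δ : ℝ) (y : E d),
      HasFDerivAt (fun y => δ⁻¹ * ⟪n B, y - x⟫) (δ⁻¹ • innerSL ℝ (n B)) y := fun δ y =>
    (((innerSL ℝ (n B)).hasFDerivAt).comp y ((hasFDerivAt_id y).sub_const x)).const_mul δ⁻¹
  have hcut : ∀ (δ : ℝ) (y : E d),
      fderiv ℝ (fun y => smoothStep (δ⁻¹ * ⟪n B, y - x⟫) * φ y) y τ =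
        smoothStep (δ⁻¹ * ⟪n B, y - x⟫) * fderiv ℝ φ y τ +
          ⟪n B, τ⟫ * ((δ⁻¹ * deriv smoothStep (δ⁻¹ * ⟪n B, y - x⟫)) * φ y) := by
    intro δ y
    have h1 := ((hasDerivAt_smoothStep (δ⁻¹ * ⟪n B, y - x⟫)).comp_hasFDerivAt y (hℓ δ y)).mul
      (hφ.differentiable (by simp) y).hasFDerivAt
    have h2 : (fun y => smoothStep (δ⁻¹ * ⟪n B, y - x⟫) * φ y) =
        (smoothStep ∘ fun y => δ⁻¹ * ⟪n B, y - x⟫) * φ := rfl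
    rw [h2, h1.fderiv]
    simp
    ring
  have hcutsmooth : ∀ δ : ℝ, ContDiff ℝ ∞ fun y => smoothStep (δ⁻¹ * ⟪n B, y - x⟫) :=
    fun δ => contDiff_smoothStep.comp
      (contDiff_const.mul ((innerSL ℝ (n B)).contDiff.comp (contDiff_id.sub contDiff_const)))
  have hκφc : ∀ δ : ℝ, Continuous fun y =>
      ((δ⁻¹ * deriv smoothStep (δ⁻¹ * ⟪n B, y - x⟫)) * φ y) • v y := fun δ => by
    have h1 : Continuous fun y : E d => deriv smoothStep (δ⁻¹ * ⟪n B, y - x⟫) :=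
      continuous_deriv_smoothStep.comp (by fun_prop)
    exact ((continuous_const.mul h1).mul hφ.continuous).smul hv
  have htest : ∀ δ : ℝ, 0 < δ →
      IsTestFunction A fun y => smoothStep (δ⁻¹ * ⟪n B, y - x⟫) * φ y := by
    intro δ hδ
    refine ⟨(hcutsmooth δ).mul hφ, hφc.mul_left, ?_⟩
    rintro y ⟨hy, hyA⟩
    have hyr : y ∈ Metric.ball x r := hφr (tsupport_mul_subset_right hy)
    have hyneg : y ∈ {y | δ⁻¹ * ⟪n B, y - x⟫ ≤ -1} := by
      refine closure_minimal (fun z hz => ?_) (isClosed_le (by fun_prop) continuous_const) hy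
      by_contra hz'
      exact hz (by simp only [smoothStep_of_ge (le_of_lt (not_le.1 hz')), zero_mul])
    refine (hrA y hyr).2 ⟨hAV hyA, ?_⟩
    by_contra hpos
    have h1 : 0 ≤ δ⁻¹ * ⟪n B, y - x⟫ := mul_nonneg (inv_pos.2 hδ).le (not_lt.1 hpos)
    have h2 : δ⁻¹ * ⟪n B, y - x⟫ ≤ -1 := hyneg
    linarith
  have key : ∀ δ : ℝ, 0 < δ →
      ∫ y in A, smoothStep (δ⁻¹ * ⟪n B, y - x⟫) •
          (φ y • G y τ + fderiv ℝ φ y τ • v y) ∂μHE[m + 1] =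
        -(⟪n B, τ⟫ • ∫ y in {y | y - x ∈ vectorSpan ℝ A},
          (δ⁻¹ * deriv smoothStep (δ⁻¹ * ⟪n B, y - x⟫)) • (φ y • v y) ∂μHE[m + 1]) := by
    intro δ hδ
    have h1 := h.greenFormula_of_isTestFunction hG hv (htest δ hδ) hτ
    have h2 : ∑ B' ∈ S, ⟪n B', τ⟫ •
        ∫ y in B', (smoothStep (δ⁻¹ * ⟪n B, y - x⟫) * φ y) • v y ∂μHE[m] = 0 := by
      refine Finset.sum_eq_zero fun B' hB' => ?_
      rw [setIntegral_eq_zero_of_forall_eq_zero, smul_zero]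
      intro y hy
      have hyA := h.subset_boundary hB' hy
      rw [image_eq_zero_of_notMem_tsupport
        (f := fun y => smoothStep (δ⁻¹ * ⟪n B, y - x⟫) * φ y)
        fun hy' => hyA.2 ((htest δ hδ).support ⟨hy', hyA.1⟩), zero_smul]
    rw [GreenFormula, h2] at h1
    have h3 : ∫ y in {y | y - x ∈ vectorSpan ℝ A},
          (δ⁻¹ * deriv smoothStep (δ⁻¹ * ⟪n B, y - x⟫)) • (φ y • v y) ∂μHE[m + 1] =
        ∫ y in A, ((δ⁻¹ * deriv smoothStep (δ⁻¹ * ⟪n B, y - x⟫)) * φ y) • v y ∂μHE[m + 1] := by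
      simp_rw [smul_smul]
      refine setIntegral_eq_of_subset_of_forall_sdiff_eq_zero
        (isClosed_setOf_sub_mem _ x).measurableSet (subset_closure.trans hAV) ?_
      rintro y ⟨hyV, hyA⟩
      by_cases hy : y ∈ Metric.ball x r
      · have hpos : 0 ≤ ⟪n B, y - x⟫ := by
          by_contra hneg
          exact hyA ((hrA y hy).2 ⟨hyV, not_le.1 hneg⟩)
        rw [deriv_smoothStep_of_gt, mul_zero, zero_mul, zero_smul]
        have := mul_nonneg (inv_pos.2 hδ).le hpos
        linarith
      · rw [hφ0 y hy, mul_zero, zero_smul]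
    rw [h3, ← integral_smul, eq_neg_iff_add_eq_zero, ← integral_add]
    · rw [← h1]
      congr 1
      funext y
      rw [hcut, smul_add, smul_smul, smul_smul, smul_smul, add_smul, add_assoc]
    · refine (((h.integrableOn_smul_weakGrad hG
        (((hcutsmooth δ).mul hφ).continuous) τ)).add (h.integrableOn_of_continuous
        (((hcutsmooth δ).continuous.mul (continuous_fderiv_apply hφ τ)).smul hv))).congr ?_
      refine Eventually.of_forall fun y => ?_
      simp [smul_add, smul_smul]
    · exact Integrable.smul ⟪n B, τ⟫ (h.integrableOn_of_continuous (hκφc δ))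
  -- pass to the limit in `key`
  have hlim1 : Tendsto (fun δ : ℝ => ∫ y in A, smoothStep (δ⁻¹ * ⟪n B, y - x⟫) •
      (φ y • G y τ + fderiv ℝ φ y τ • v y) ∂μHE[m + 1]) (𝓝[>] 0)
      (𝓝 (∫ y in A, (φ y • G y τ + fderiv ℝ φ y τ • v y) ∂μHE[m + 1])) := by
    have hint := h.integrableOn_green hG hv hφ τ
    refine tendsto_integral_filter_of_dominated_convergence _ ?_ ?_ hint.norm ?_
    · exact Eventually.of_forall fun δ =>
        (hcutsmooth δ).continuous.aestronglyMeasurable.smul hint.aestronglyMeasurable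
    · refine Eventually.of_forall fun δ => Eventually.of_forall fun y => ?_
      rw [norm_smul]
      exact mul_le_of_le_one_left (norm_nonneg _) (abs_smoothStep_le _)
    · refine ae_restrict_of_forall_mem h.measurableSet fun y hyA => ?_
      by_cases hy : y ∈ Metric.ball x r
      · refine tendsto_const_nhds.congr' ?_
        have hneg := ((hrA y hy).1 hyA).2
        have hbot : Tendsto (fun δ : ℝ => δ⁻¹ * ⟪n B, y - x⟫) (𝓝[>] 0) atBot :=
          tendsto_inv_nhdsGT_zero.atTop_mul_const_of_neg hneg
        filter_upwards [hbot (Iic_mem_atBot (-2))] with δ hδ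
        rw [smoothStep_of_le hδ, one_smul]
      · simp [hφ0 y hy, hφ0' y hy]
  have hlim2 := ((tendsto_integral_layer h.finrank_eq hn.tangent hn.norm_eq x
    (hφ.continuous.smul hv) hφc.smul_right continuous_deriv_smoothStep
    hasCompactSupport_deriv_smoothStep).const_smul ⟪n B, τ⟫).neg
  have hlim3 := hlim1.congr' (f₂ := fun δ : ℝ =>
      -(⟪n B, τ⟫ • ∫ y in {y | y - x ∈ vectorSpan ℝ A},
          (δ⁻¹ * deriv smoothStep (δ⁻¹ * ⟪n B, y - x⟫)) • (φ y • v y) ∂μHE[m + 1]))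
    (by filter_upwards [self_mem_nhdsWithin] with δ hδ using key δ hδ)
  have := tendsto_nhds_unique hlim3 hlim2
  rw [GreenFormula, this, hbd, integral_deriv_smoothStep]
  simp

end Green

/-! ### The divergence theorem -/

section Divergence
variable {d m : ℕ} {A : Set (E d)} {S : Finset (Set (E d))} {n : Set (E d) → E d}
  {N : Set (E d)} {v : E d → E d} {G : E d → E d →L[ℝ] E d}

lemma IsFlatPiece.exists_local_greenFormula (h : IsFlatPiece m A S n N)
    (hG : HasWeakGrad A μHE[m + 1] v G) (hv : Continuous v) {τ : E d} (hτ : τ ∈ vectorSpan ℝ A)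
    {x : E d} (hx : x ∉ N) : ∃ U : Set (E d), IsOpen U ∧ x ∈ U ∧
      ∀ φ : E d → ℝ, ContDiff ℝ ∞ φ → HasCompactSupport φ → tsupport φ ⊆ U →
        GreenFormula m A S n v G τ φ := by
  by_cases hxA : x ∈ A
  · obtain ⟨U, hU, hAU⟩ := h.relOpen
    refine ⟨U, hU, (hAU ▸ hxA : x ∈ U ∩ affineSpan ℝ A).1, fun φ hφ hφc hφU => ?_⟩
    refine h.greenFormula_of_isTestFunction hG hv ⟨hφ, hφc, fun y hy => ?_⟩ hτ
    have hy' : y ∈ U ∩ affineSpan ℝ A := ⟨hφU hy.1, closure_subset_affineSpan A hy.2⟩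
    rwa [← hAU] at hy'
  by_cases hxc : x ∈ closure A
  · have hxb : x ∈ (⋃ B ∈ S, B) ∪ N := h.boundary_eq ▸ ⟨hxc, hxA⟩
    obtain ⟨B, hB, hxB⟩ := mem_iUnion₂.1 (hxb.resolve_right hx)
    obtain ⟨r, hr, hrA, hrB, hrS⟩ := h.exists_ball hB hxB
    exact ⟨Metric.ball x r, Metric.isOpen_ball, Metric.mem_ball_self hr, fun φ hφ hφc hφU =>
      h.greenFormula_of_ball hG hv hB hxB hτ hrA hrB hrS hφ hφc hφU⟩
  · exact ⟨(closure A)ᶜ, isClosed_closure.isOpen_compl, hxc, fun φ hφ hφc hφU =>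
      h.greenFormula_of_isTestFunction hG hv
        ⟨hφ, hφc, fun y hy => (hφU hy.1 hy.2).elim⟩ hτ⟩

/-- The local Green formulas are glued with a partition of unity. -/
lemma IsFlatPiece.greenFormula_of_disjoint (h : IsFlatPiece m A S n N)
    (hG : HasWeakGrad A μHE[m + 1] v G) (hv : Continuous v) {τ : E d} (hτ : τ ∈ vectorSpan ℝ A)
    {φ : E d → ℝ} (hφ : ContDiff ℝ ∞ φ) (hφc : HasCompactSupport φ)
    (hφN : Disjoint (tsupport φ) N) : GreenFormula m A S n v G τ φ := by
  classical
  choose! U hUo hxU hU using fun (x : E d) (hx : x ∈ tsupport φ) =>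
    h.exists_local_greenFormula hG hv hτ (disjoint_left.1 hφN hx)
  obtain ⟨t, ht, htU⟩ := IsCompact.elim_nhds_subcover hφc U
    fun x hx => (hUo x hx).mem_nhds (hxU x hx)
  obtain ⟨ρ, hρ⟩ := SmoothPartitionOfUnity.exists_isSubordinate (modelWithCornersSelf ℝ (E d))
    (isClosed_tsupport φ) (fun i : t => U i) (fun i => hUo i (ht i i.2))
    (fun x hx => by
      obtain ⟨i, hi, hxi⟩ := mem_iUnion₂.1 (htU hx)
      exact mem_iUnion.2 ⟨⟨i, hi⟩, hxi⟩)
  have hρs : ∀ i, ContDiff ℝ ∞ (ρ i) := fun i => (ρ i).contMDiff.contDiff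
  have hsum : φ = fun x => ∑ i, ρ i x * φ x := by
    funext x
    by_cases hx : x ∈ tsupport φ
    · have := ρ.sum_eq_one hx
      rw [finsum_eq_sum_of_fintype] at this
      rw [← Finset.sum_mul, this, one_mul]
    · rw [image_eq_zero_of_notMem_tsupport hx]
      simp
  rw [hsum]
  refine h.greenFormula_sum hG hv Finset.univ (fun i _ => (hρs i).mul hφ) fun i _ => ?_
  exact hU i (ht i i.2) _ ((hρs i).mul hφ) hφc.mul_left
    ((tsupport_mul_subset_left).trans (hρ i))

lemma HasWeakGrad.congr {μ : Measure (E d)} {w : E d → E d} (hA : MeasurableSet A)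
    (hG : HasWeakGrad A μ v G) (hvw : EqOn v w A) : HasWeakGrad A μ w G := by
  refine ⟨hG.memLp, hG.tangential, fun φ hφ τ hτ => ?_⟩
  rw [← hG.integral_eq φ hφ τ hτ]
  exact setIntegral_congr_fun hA fun x hx => by simp only [hvw hx]

/-- The divergence theorem for a globally continuous function and a tangent direction: Green's formula
for cut-off functions which vanish near the negligible part of the boundary, in the limit. -/
lemma IsFlatPiece.integral_weakGrad_of_continuous (h : IsFlatPiece m A S n N)
    (hG : HasWeakGrad A μHE[m + 1] v G) (hv : Continuous v) {τ : E d} (hτ : τ ∈ vectorSpan ℝ A) :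
    ∫ x in A, G x τ ∂μHE[m + 1] = ∑ B ∈ S, ⟪n B, τ⟫ • ∫ x in B, v x ∂μHE[m] := by
  obtain ⟨x₀, hx₀⟩ := h.nonempty
  obtain ⟨C, hC, hball⟩ := exists_measure_closedBall_le h.finrank_eq x₀
  choose η hηs hη01 hηN hη1 hηint using fun k : ℕ =>
    exists_cutoff h.isCompact_null h.measure_null _ hC hball (Nat.one_div_pos_of_nat (n := k))
  obtain ⟨C', hC'⟩ := h.isBounded.isCompact_closure.exists_bound_of_continuousOn hv.continuousOn
  have hC'0 : 0 ≤ C' := (norm_nonneg _).trans (hC' x₀ (subset_closure hx₀))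
  -- a compactly supported function which is `1` around the closure of `A`
  obtain ⟨R, hR0, hR⟩ := h.isBounded.closure.subset_ball_lt 0 0
  let β : ContDiffBump (0 : E d) := ⟨R, R + 1, hR0, by linarith⟩
  have hβ : ∀ x ∈ closure A, (β : E d → ℝ) =ᶠ[𝓝 x] fun _ => 1 := fun x hx => by
    filter_upwards [Metric.isOpen_ball.mem_nhds (hR hx)] with y hy
    exact β.one_of_mem_closedBall (Metric.ball_subset_closedBall hy)
  have hβη : ∀ k, ∀ x ∈ closure A, (fun x => β x * η k x) =ᶠ[𝓝 x] η k := fun k x hx => by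
    filter_upwards [hβ x hx] with y hy
    rw [hy, one_mul]
  have hgreen : ∀ k, ∫ x in A, η k x • G x τ ∂μHE[m + 1] +
      ∫ x in A, fderiv ℝ (η k) x τ • v x ∂μHE[m + 1] =
        ∑ B ∈ S, ⟪n B, τ⟫ • ∫ x in B, η k x • v x ∂μHE[m] := by
    intro k
    have h1 : GreenFormula m A S n v G τ fun x => β x * η k x :=
      h.greenFormula_of_disjoint hG hv hτ (β.contDiff.mul (hηs k)) β.hasCompactSupport.mul_right
        ((hηN k).mono_left tsupport_mul_subset_right)
    rw [← integral_add (h.integrableOn_smul_weakGrad hG (hηs k).continuous τ)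
      (h.integrableOn_of_continuous ((continuous_fderiv_apply (hηs k) τ).smul hv) :
        IntegrableOn (fun x => fderiv ℝ (η k) x τ • v x) A μHE[m + 1])]
    rw [GreenFormula] at h1
    have h2 : ∫ x in A, (η k x • G x τ + fderiv ℝ (η k) x τ • v x) ∂μHE[m + 1] =
        ∫ x in A, ((β x * η k x) • G x τ + fderiv ℝ (fun x => β x * η k x) x τ • v x)
          ∂μHE[m + 1] := by
      refine setIntegral_congr_fun h.measurableSet fun x hx => ?_
      have hx' := hβη k x (subset_closure hx)
      simp only [hx'.fderiv_eq, hx'.eq_of_nhds]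
    rw [h2, h1]
    refine Finset.sum_congr rfl fun B hB => ?_
    congr 1
    refine setIntegral_congr_fun (h.measurableSet_of_mem hB) fun x hx => ?_
    simp only [(hβη k x (h.subset_boundary hB hx).1).eq_of_nhds]
  have hηlim : ∀ x ∉ N, ∀ᶠ k in atTop, η k x = 1 := by
    intro x hx
    obtain ⟨r, hr, hrN⟩ := Metric.isOpen_iff.1 h.isCompact_null.isClosed.isOpen_compl x hx
    filter_upwards [(tendsto_one_div_add_atTop_nhds_zero_nat (𝕜 := ℝ)).eventually_lt_const hr]
      with k hk
    refine hη1 k x fun z hz => ?_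
    by_contra hlt
    refine hrN ?_ hz
    rw [Metric.mem_ball, dist_comm]
    linarith [not_le.1 hlt]
  have hηabs : ∀ k x, ‖η k x‖ ≤ 1 := fun k x => by
    rw [Real.norm_of_nonneg (hη01 k x).1]
    exact (hη01 k x).2
  have hdct : ∀ (f : E d → E d) (T : Set (E d)) (μ : Measure (E d)), MeasurableSet T →
      Disjoint T N → IntegrableOn f T μ →
      Tendsto (fun k => ∫ x in T, η k x • f x ∂μ) atTop (𝓝 (∫ x in T, f x ∂μ)) := by
    intro f T μ hT hTN hf
    refine tendsto_integral_of_dominated_convergence (fun x => ‖f x‖) ?_ hf.norm ?_ ?_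
    · exact fun k => (hηs k).continuous.aestronglyMeasurable.smul hf.aestronglyMeasurable
    · refine fun k => Eventually.of_forall fun x => ?_
      rw [norm_smul]
      exact mul_le_of_le_one_left (norm_nonneg _) (hηabs k x)
    · refine ae_restrict_of_forall_mem hT fun x hx => ?_
      refine tendsto_const_nhds.congr' ?_
      filter_upwards [hηlim x (disjoint_left.1 hTN hx)] with k hk
      rw [hk, one_smul]
  have hAN : Disjoint A N := disjoint_right.2 fun x hx hxA => by
    have : x ∈ closure A \ A := h.boundary_eq ▸ Or.inr hx
    exact this.2 hxA
  have hlim1 := hdct (fun x => G x τ) A μHE[m + 1] h.measurableSet hAN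
    ((h.integrableOn_weakGrad hG).apply_continuousLinearMap τ)
  have hlim2 : Tendsto (fun k => ∫ x in A, fderiv ℝ (η k) x τ • v x ∂μHE[m + 1]) atTop (𝓝 0) := by
    refine squeeze_zero_norm (a := fun k : ℕ => C' * ‖τ‖ * (1 / ((k : ℝ) + 1))) (fun k => ?_) ?_
    · have hb : ∫⁻ x in A, ‖fderiv ℝ (η k) x τ • v x‖ₑ ∂μHE[m + 1] ≤
          ENNReal.ofReal (C' * ‖τ‖ * (1 / ((k : ℝ) + 1))) := by
        calc ∫⁻ x in A, ‖fderiv ℝ (η k) x τ • v x‖ₑ ∂μHE[m + 1]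
            ≤ ∫⁻ x in A, ENNReal.ofReal (C' * ‖τ‖) * ‖fderiv ℝ (η k) x‖ₑ ∂μHE[m + 1] := by
              refine setLIntegral_mono' h.measurableSet fun x hx => ?_
              rw [← ofReal_norm, ← ofReal_norm, ← ENNReal.ofReal_mul (by positivity), norm_smul]
              apply ENNReal.ofReal_le_ofReal
              calc ‖fderiv ℝ (η k) x τ‖ * ‖v x‖ ≤ (‖fderiv ℝ (η k) x‖ * ‖τ‖) * C' := by
                    gcongr
                    · exact ContinuousLinearMap.le_opNorm _ _
                    · exact hC' x (subset_closure hx)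
                _ = C' * ‖τ‖ * ‖fderiv ℝ (η k) x‖ := by ring
          _ = ENNReal.ofReal (C' * ‖τ‖) * ∫⁻ x in A, ‖fderiv ℝ (η k) x‖ₑ ∂μHE[m + 1] :=
              lintegral_const_mul' _ _ ENNReal.ofReal_ne_top
          _ ≤ ENNReal.ofReal (C' * ‖τ‖) * ENNReal.ofReal (1 / ((k : ℝ) + 1)) := by
              gcongr
              refine le_trans (lintegral_mono' (Measure.restrict_mono ?_ le_rfl) le_rfl) (hηint k)
              exact fun y hy => vsub_mem_vectorSpan ℝ hy hx₀
          _ = _ := (ENNReal.ofReal_mul (by positivity)).symm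
      rw [← ENNReal.ofReal_le_ofReal_iff (by positivity), ofReal_norm]
      exact (enorm_integral_le_lintegral_enorm _).trans hb
    · simpa using (tendsto_one_div_add_atTop_nhds_zero_nat (𝕜 := ℝ)).const_mul (C' * ‖τ‖)
  have hlim3 : Tendsto (fun k => ∑ B ∈ S, ⟪n B, τ⟫ • ∫ x in B, η k x • v x ∂μHE[m]) atTop
      (𝓝 (∑ B ∈ S, ⟪n B, τ⟫ • ∫ x in B, v x ∂μHE[m])) :=
    tendsto_finsetSum _ fun B hB => (hdct v B μHE[m] (h.measurableSet_of_mem hB)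
      (h.disjoint_null B hB) (h.integrableOn_mem_of_continuous hB hv)).const_smul _
  have hlim := hlim1.add hlim2
  rw [add_zero] at hlim
  exact tendsto_nhds_unique (hlim.congr hgreen) hlim3

/-- The **divergence theorem** on a flat piece `A` for functions which are continuous on the closure
of `A` and have a square integrable weak gradient. -/
theorem IsFlatPiece.integral_weakGrad (h : IsFlatPiece m A S n N)
    (hv : ContinuousOn v (closure A)) (hG : HasWeakGrad A μHE[m + 1] v G) (τ : E d) :
    ∫ x in A, G x τ ∂μHE[m + 1] = ∑ B ∈ S, ⟪n B, τ⟫ • ∫ x in B, v x ∂μHE[m] := by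
  obtain ⟨w, hw⟩ := ContinuousMap.exists_restrict_eq isClosed_closure
    (⟨(closure A).domRestrict v, hv.domRestrict⟩ : C(closure A, E d))
  have hvw : EqOn v w (closure A) := fun x hx =>
    (DFunLike.congr_fun hw (⟨x, hx⟩ : closure A)).symm
  set P := (vectorSpan ℝ A).starProjection with hP
  have hPmem : P τ ∈ vectorSpan ℝ A := Submodule.starProjection_apply_mem _ _
  have hPorth : τ - P τ ∈ (vectorSpan ℝ A)ᗮ := Submodule.sub_starProjection_mem_orthogonal _
  have h1 : ∫ x in A, G x τ ∂μHE[m + 1] = ∫ x in A, G x (P τ) ∂μHE[m + 1] := by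
    refine integral_congr_ae ?_
    filter_upwards [hG.tangential] with x hx
    have := hx _ hPorth
    rwa [map_sub, sub_eq_zero] at this
  rw [h1, h.integral_weakGrad_of_continuous
    (hG.congr h.measurableSet (hvw.mono subset_closure)) w.continuous hPmem]
  refine Finset.sum_congr rfl fun B hB => ?_
  have h2 : ⟪n B, P τ⟫ = ⟪n B, τ⟫ := by
    have := Submodule.inner_right_of_mem_orthogonal (h.isOutwardNormal B hB).tangent hPorth
    rw [inner_sub_right, sub_eq_zero] at this
    exact this.symm
  rw [h2, setIntegral_congr_fun (h.measurableSet_of_mem hB) fun x hx =>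
    (hvw (h.subset_boundary hB hx).1).symm]

end Divergence

/-! ### Elliptic projections and mean gradients -/

section Elliptic
variable {d : ℕ}

lemma tensor_apply (a n x : E d) : tensor a n x = ⟪n, x⟫ • a := rfl

lemma tensor_smul_left (c : ℝ) (a n : E d) : tensor (c • a) n = c • tensor a n := by
  ext1 x
  simp only [tensor_apply, smul_apply]
  exact smul_comm _ _ _

lemma tensor_sub_left (a b n : E d) : tensor (a - b) n = tensor a n - tensor b n := by
  ext1 x
  simp [tensor_apply, smul_sub]

lemma clm_ext_single {T T' : E d →L[ℝ] E d}
    (h : ∀ j, T (EuclideanSpace.single j 1) = T' (EuclideanSpace.single j 1)) : T = T' := by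
  apply ContinuousLinearMap.coe_injective
  refine (EuclideanSpace.basisFun (Fin d) ℝ).toBasis.ext fun j => ?_
  simpa using h j

lemma frob_self_eq_zero {T : E d →L[ℝ] E d} (h : frob T T = 0) : T = 0 := by
  refine clm_ext_single fun j => ?_
  have := (Finset.sum_eq_zero_iff_of_nonneg fun j _ => real_inner_self_nonneg).1 h j
    (Finset.mem_univ j)
  simpa using this

lemma frob_sub_left (T T' R : E d →L[ℝ] E d) : frob (T - T') R = frob T R - frob T' R := by
  simp [frob, inner_sub_left]

lemma frob_smul_left (c : ℝ) (T R : E d →L[ℝ] E d) : frob (c • T) R = c * frob T R := by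
  simp [frob, inner_smul_left, Finset.mul_sum]

lemma integral_frob {A : Set (E d)} {μ : Measure (E d)} {G : E d → E d →L[ℝ] E d}
    (hG : IntegrableOn G A μ) (T : E d →L[ℝ] E d) :
    ∫ x in A, frob (G x) T ∂μ = frob (∫ x in A, G x ∂μ) T := by
  have hj : ∀ j : Fin d, IntegrableOn (fun x => G x (EuclideanSpace.single j 1)) A μ :=
    fun j => hG.apply_continuousLinearMap _
  simp only [frob]
  rw [integral_finsetSum _ fun j _ => (hj j).inner_const _]
  refine Finset.sum_congr rfl fun j _ => ?_
  rw [ContinuousLinearMap.integral_apply hG, real_inner_comm, ← integral_inner (hj j)]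
  simp_rw [real_inner_comm]

/-- The linear part of an affine map, as a continuous linear map. -/
def linPart (w : E d →ᵃ[ℝ] E d) : E d →L[ℝ] E d := LinearMap.toContinuousLinearMap w.linear

lemma affineMap_apply_eq (w : E d →ᵃ[ℝ] E d) (x c : E d) :
    w x = linPart w (x - c) + w c := by
  have := w.map_vadd c (x - c)
  simpa [linPart] using this

lemma linPart_affineAt (L : E d →L[ℝ] E d) (c b : E d) : linPart (affineAt L c b) = L := by
  ext1 x
  rfl

lemma continuous_affineMap (w : E d →ᵃ[ℝ] E d) : Continuous w :=
  w.continuous_of_finiteDimensional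

lemma tgrad_affineMap (A : Set (E d)) (w : E d →ᵃ[ℝ] E d) (x : E d) :
    tgrad A w x = (linPart w).comp (vectorSpan ℝ A).starProjection := by
  have h : HasFDerivAt w (linPart w) x := by
    have h1 : (w : E d → E d) = fun y => linPart w (y - 0) + w 0 :=
      funext fun y => affineMap_apply_eq w y 0
    rw [h1]
    simpa using ((linPart w).hasFDerivAt (x := x)).add_const (w 0)
  rw [tgrad, h.fderiv]

/-- An affine map is the elliptic projection of `v` if and only if its tangential gradient is the mean
value of the weak gradient of `v`, and its value at `c` is the prescribed one. -/
lemma isEllipticProjection_iff {A : Set (E d)} {μ : Measure (E d)} (h0 : 0 < μ A) (htop : μ A < ⊤)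
    {v : E d → E d} (hex : ∃ G, HasWeakGrad A μ v G) {D : E d →L[ℝ] E d}
    (hD : D.comp (vectorSpan ℝ A).starProjection = D)
    (hmean : ∀ G, HasWeakGrad A μ v G → ∫ x in A, G x ∂μ = (μ A).toReal • D)
    (c b : E d) (w : E d →ᵃ[ℝ] E d) :
    IsEllipticProjection A μ c b v w ↔
      (linPart w).comp (vectorSpan ℝ A).starProjection = D ∧ w c = b := by
  have hfin : IsFiniteMeasure (μ.restrict A) := ⟨by rwa [Measure.restrict_apply_univ]⟩
  have hpos : 0 < (μ A).toReal := ENNReal.toReal_pos h0.ne' htop.ne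
  have hiff : ∀ G, HasWeakGrad A μ v G → ∀ q : E d →ᵃ[ℝ] E d,
      (∫ x in A, frob (tgrad A w x) (tgrad A q x) ∂μ = ∫ x in A, frob (G x) (tgrad A q x) ∂μ ↔
        frob ((linPart w).comp (vectorSpan ℝ A).starProjection - D)
          ((linPart q).comp (vectorSpan ℝ A).starProjection) = 0) := by
    intro G hG q
    simp_rw [tgrad_affineMap]
    rw [integral_frob (hG.memLp.integrable one_le_two), hmean G hG, setIntegral_const,
      frob_smul_left, frob_sub_left, sub_eq_zero, smul_eq_mul, Measure.real]
    exact mul_right_inj' hpos.ne'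
  rw [IsEllipticProjection, and_congr_left_iff]
  intro _
  constructor
  · intro h
    obtain ⟨G, hG⟩ := hex
    -- test with the difference of both sides
    have h1 := (hiff G hG (affineAt (linPart w - D) 0 0)).1 (h G hG _)
    rw [linPart_affineAt, ContinuousLinearMap.sub_comp, hD] at h1
    exact sub_eq_zero.1 (frob_self_eq_zero h1)
  · intro h G hG q
    rw [hiff G hG q, h, sub_self]
    simp [frob]

/-- Affine maps are equal on `A` as soon as they have the same tangential gradient along `A` and agree at
one point of the affine span of `A`. -/
lemma eqOn_affineAt_iff {A : Set (E d)} {D : E d →L[ℝ] E d}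
    (hD : D.comp (vectorSpan ℝ A).starProjection = D) {c : E d} (hc : c ∈ affineSpan ℝ A)
    (b : E d) (w : E d →ᵃ[ℝ] E d) :
    EqOn w (affineAt D c b) A ↔
      (linPart w).comp (vectorSpan ℝ A).starProjection = D ∧ w c = b := by
  constructor
  · intro h
    have h1 : ∀ y ∈ affineSpan ℝ A, w y = affineAt D c b y := by
      have hle : affineSpan ℝ A ≤ (AffineSubspace.mk' (0 : E d) ⊥).comap (w - affineAt D c b) := by
        rw [affineSpan_le]
        intro y hy
        simp [AffineSubspace.mem_mk', h hy]
      intro y hy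
      have := hle hy
      simpa [AffineSubspace.mem_mk', sub_eq_zero] using this
    have hwc : w c = b := by
      rw [h1 c hc]
      simp [affineAt]
    refine ⟨?_, hwc⟩
    rw [← hD]
    ext1 x
    set τ := (vectorSpan ℝ A).starProjection x with hτ
    have hτV : τ ∈ (affineSpan ℝ A).direction := by
      rw [direction_affineSpan]
      exact Submodule.starProjection_apply_mem _ _
    have h2 := h1 _ (AffineSubspace.vadd_mem_of_mem_direction hτV hc)
    rw [affineMap_apply_eq w _ c, hwc] at h2
    simpa [affineAt] using h2
  · rintro ⟨h1, h2⟩ y hy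
    have hV : y - c ∈ vectorSpan ℝ A := by
      rw [← direction_affineSpan]
      exact AffineSubspace.vsub_mem_direction (subset_affineSpan ℝ A hy) hc
    have h3 : linPart w (y - c) = D (y - c) := by
      rw [← h1, ContinuousLinearMap.comp_apply, Submodule.starProjection_eq_self_iff.2 hV]
    rw [affineMap_apply_eq w y c, h2, h3]
    rfl

lemma IsFlatPiece.integral_weakGrad_eq_sum_tensor {m : ℕ} {A : Set (E d)} {S : Finset (Set (E d))}
    {n : Set (E d) → E d} {N : Set (E d)} {v : E d → E d} {G : E d → E d →L[ℝ] E d}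
    (h : IsFlatPiece m A S n N) (hv : ContinuousOn v (closure A))
    (hG : HasWeakGrad A μHE[m + 1] v G) :
    ∫ x in A, G x ∂μHE[m + 1] = ∑ B ∈ S, tensor (∫ x in B, v x ∂μHE[m]) (n B) := by
  ext1 τ
  rw [ContinuousLinearMap.integral_apply (h.integrableOn_weakGrad hG), h.integral_weakGrad hv hG,
    sum_apply]
  rfl

/-! ### Integrals of affine maps -/

/-- An affine map is integrated exactly by the value at the center of mass. -/
lemma setIntegral_affineAt {A : Set (E d)} (hA : Bornology.IsBounded A) (hAm : MeasurableSet A)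
    {μ : Measure (E d)} (h0 : 0 < μ A) (htop : μ A < ⊤) (L : E d →L[ℝ] E d) {c : E d}
    (hc : c = (1 / (μ A).toReal) • ∫ x in A, x ∂μ) (b : E d) :
    ∫ x in A, affineAt L c b x ∂μ = (μ A).toReal • b := by
  have hfin : IsFiniteMeasure (μ.restrict A) := ⟨by rwa [Measure.restrict_apply_univ]⟩
  have hpos : 0 < (μ A).toReal := ENNReal.toReal_pos h0.ne' htop.ne
  have hid : IntegrableOn (fun x : E d => x) A μ :=
    integrableOn_of_continuousOn hA hAm htop continuousOn_id
  have hsub : IntegrableOn (fun x : E d => x - c) A μ := hid.sub (integrable_const c)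
  have h1 : ∫ x in A, affineAt L c b x ∂μ = ∫ x in A, (L (x - c) + b) ∂μ := rfl
  rw [h1, integral_add (L.integrable_comp hsub) (integrable_const b), L.integral_comp_comm hsub,
    integral_sub hid (integrable_const c), setIntegral_const, setIntegral_const, Measure.real, hc,
    smul_smul, mul_one_div_cancel hpos.ne', one_smul, sub_self, map_zero, zero_add]

lemma isCompact_segment (s₁ s₂ : E d) : IsCompact (segment ℝ s₁ s₂) := by
  rw [← convexHull_pair]
  exact (toFinite {s₁, s₂}).isCompact_convexHull ℝ

/-- The reflection of a segment which exchanges its end points shows that the mean value of an affine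
map on the segment is the mean of its values at the end points. -/
lemma setIntegral_openSegment {k : ℕ} (s₁ s₂ : E d) (htop : μHE[k] (openSegment ℝ s₁ s₂) < ⊤)
    (hm : MeasurableSet (openSegment ℝ s₁ s₂)) (p : E d →ᵃ[ℝ] E d) :
    ∫ x in openSegment ℝ s₁ s₂, p x ∂μHE[k] =
      (μHE[k] (openSegment ℝ s₁ s₂)).toReal • ((1 / 2 : ℝ) • (p s₁ + p s₂)) := by
  have hfin : IsFiniteMeasure ((μHE[k] : Measure (E d)).restrict (openSegment ℝ s₁ s₂)) :=
    ⟨by rwa [Measure.restrict_apply_univ]⟩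
  have hbdd : Bornology.IsBounded (openSegment ℝ s₁ s₂) :=
    (isCompact_segment s₁ s₂).isBounded.subset (openSegment_subset_segment ℝ s₁ s₂)
  have hint : IntegrableOn p (openSegment ℝ s₁ s₂) μHE[k] :=
    integrableOn_of_continuousOn hbdd hm htop (continuous_affineMap p).continuousOn
  let R : E d ≃ᵢ E d := IsometryEquiv.subLeft (s₁ + s₂)
  have hR : ∀ x, R x = s₁ + s₂ - x := fun x => rfl
  have hRmem : ∀ x ∈ openSegment ℝ s₁ s₂, R x ∈ openSegment ℝ s₁ s₂ := by
    rintro x ⟨a, b, ha, hb, hab, rfl⟩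
    refine ⟨b, a, hb, ha, by linarith, ?_⟩
    rw [hR]
    have : a = 1 - b := by linarith
    rw [this]
    module
  have hRpre : R ⁻¹' openSegment ℝ s₁ s₂ = openSegment ℝ s₁ s₂ := by
    ext x
    refine ⟨fun hx => ?_, hRmem x⟩
    have := hRmem _ hx
    rwa [hR, hR, sub_sub_cancel] at this
  have hpR : ∀ x, p (R x) = p s₁ + p s₂ - p x := by
    intro x
    rw [affineMap_apply_eq p (R x) s₁, affineMap_apply_eq p s₂ x, hR, add_sub_assoc,
      add_sub_cancel_left]
    abel
  have h1 := (R.measurePreserving_euclideanHausdorffMeasure k).setIntegral_preimage_emb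
    R.toHomeomorph.measurableEmbedding p (openSegment ℝ s₁ s₂)
  rw [hRpre] at h1
  simp_rw [hpR] at h1
  rw [integral_sub (integrable_const _) hint, setIntegral_const, Measure.real] at h1
  have h2 : (2 : ℝ) • ∫ x in openSegment ℝ s₁ s₂, p x ∂μHE[k] =
      (μHE[k] (openSegment ℝ s₁ s₂)).toReal • (p s₁ + p s₂) := by
    rw [two_smul, eq_comm, ← sub_eq_iff_eq_add]
    exact h1
  rw [smul_comm, ← h2, smul_smul]
  norm_num

end Elliptic

/-! ### The cells and the faces of a mesh are flat pieces -/

namespace PolytopalMesh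

variable {d : ℕ} {M : PolytopalMesh d}

lemma mem_facesOf {K σ : Set (E d)} : σ ∈ M.facesOf K ↔ σ ∈ M.faces ∧ σ ⊆ closure K := by
  classical
  exact Finset.mem_filter

lemma mem_edgesOf {σ e : Set (E d)} : e ∈ M.edgesOf σ ↔ e ∈ M.edges ∧ e ⊆ closure σ := by
  classical
  exact Finset.mem_filter

lemma mem_nodesOf {A : Set (E d)} {s : E d} : s ∈ M.nodesOf A ↔ s ∈ M.nodes ∧ s ∈ closure A := by
  classical
  exact Finset.mem_filter

lemma plusFaces_subset (K : Set (E d)) : M.plusFaces K ⊆ M.facesOf K := by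
  classical
  exact Finset.filter_subset _ _

/-- An edge is the open segment between two nodes `s₁`, `s₂`, which are its only nodes. -/
lemma exists_segment {e : Set (E d)} (he : e ∈ M.edges) :
    ∃ s₁ ∈ M.nodesOf e, ∃ s₂ ∈ M.nodesOf e, (s₁ = s₂ ↔ d = 2) ∧ e = openSegment ℝ s₁ s₂ ∧
      closure e = segment ℝ s₁ s₂ ∧ (∀ s ∈ M.nodesOf e, s = s₁ ∨ s = s₂) := by
  obtain ⟨s₁, hs₁, s₂, hs₂, hs, hes, hn⟩ := M.edge_segment e he
  have hcl : closure e = segment ℝ s₁ s₂ := by rw [hes, closure_openSegment]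
  refine ⟨s₁, mem_nodesOf.2 ⟨hs₁, hcl ▸ left_mem_segment ℝ s₁ s₂⟩, s₂,
    mem_nodesOf.2 ⟨hs₂, hcl ▸ right_mem_segment ℝ s₁ s₂⟩, hs, hes, hcl, fun s hs => ?_⟩
  rw [mem_nodesOf] at hs
  exact hn s hs.1 hs.2

lemma isCompact_closure_edge {e : Set (E d)} (he : e ∈ M.edges) :
    IsCompact (closure e) := by
  obtain ⟨s₁, -, s₂, -, -, -, hcl, -⟩ := exists_segment he
  rw [hcl]
  exact isCompact_segment s₁ s₂

lemma hausdorffMeasure_closure_edge_lt_top (hd : d = 2 ∨ d = 3) {e : Set (E d)}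
    (he : e ∈ M.edges) : μH[(d - 2 : ℕ)] (closure e) < ⊤ := by
  obtain ⟨s₁, -, s₂, -, hs, -, hcl, -⟩ := exists_segment he
  rw [hcl]
  rcases hd with rfl | rfl
  · obtain rfl := hs.2 rfl
    rw [segment_same]
    simp
  · simp only [Nat.reduceSub, Nat.cast_one, hausdorffMeasure_segment]
    exact edist_lt_top _ _

lemma measure_edge_lt_top (hd : d = 2 ∨ d = 3) {e : Set (E d)} (he : e ∈ M.edges) :
    μHE[d - 2] e < ⊤ := by
  refine (measure_mono subset_closure).trans_lt ?_
  rw [Measure.euclideanHausdorffMeasure_def, Measure.smul_apply]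
  exact ENNReal.mul_lt_top ENNReal.coe_lt_top (hausdorffMeasure_closure_edge_lt_top hd he)

lemma hausdorffMeasure_closure_edge (hd : d = 2 ∨ d = 3) {e : Set (E d)} (he : e ∈ M.edges) :
    μH[(d - 1 : ℕ)] (closure e) = 0 := by
  have hlt : ((d - 2 : ℕ) : ℝ) < ((d - 1 : ℕ) : ℝ) := by
    rw [Nat.cast_lt]
    omega
  exact (Measure.hausdorffMeasure_zero_or_top hlt (closure e)).resolve_right
    (hausdorffMeasure_closure_edge_lt_top hd he).ne

/-- The relative boundary of an edge consists of nodes, and it is empty in dimension two, where the edges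
are points. -/
lemma endpoints_of_edge (hd : d = 2 ∨ d = 3) {e : Set (E d)} (he : e ∈ M.edges) {s : E d}
    (hs : s ∈ closure e \ e) : d = 3 ∧ s ∈ M.nodesOf e := by
  obtain ⟨s₁, hs₁, s₂, hs₂, h12, hes, hcl, -⟩ := exists_segment he
  rw [hcl, ← insert_endpoints_openSegment, ← hes] at hs
  obtain ⟨hs | hs | hs, hse⟩ := hs
  all_goals first | exact (hse hs).elim | skip
  all_goals
    refine ⟨?_, by rw [hs]; assumption⟩
    refine hd.resolve_left fun hd2 => hse ?_
    obtain rfl := h12.2 hd2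
    rw [hes, openSegment_same, hs]
    rfl

lemma notMem_edge_of_node (hd : d = 3) {e : Set (E d)} (he : e ∈ M.edges) {s : E d}
    (hs : s ∈ M.nodes) : s ∉ e := by
  intro hse
  obtain ⟨s₁, hs₁, s₂, hs₂, h12, hes, hcl, hn⟩ := exists_segment he
  have hne : s₁ ≠ s₂ := fun h => by
    have := h12.1 h
    omega
  rcases hn s (mem_nodesOf.2 ⟨hs, subset_closure hse⟩) with rfl | rfl
  · rw [hes, left_mem_openSegment_iff] at hse
    exact hne hse
  · rw [hes, right_mem_openSegment_iff] at hse
    exact hne hse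

/-- The end points of the edges of the face `σ`, as the relative boundary points of these edges; there are
none in dimension two, where the edges are points. -/
def edgeEnds (M : PolytopalMesh d) (σ : Set (E d)) : Set (E d) :=
  ⋃ e ∈ M.edgesOf σ, closure e \ e

lemma edgeEnds_subset (hd : d = 2 ∨ d = 3) (σ : Set (E d)) :
    M.edgeEnds σ ⊆ {s | d = 3 ∧ s ∈ M.nodes} := by
  intro s hs
  obtain ⟨e, he, hse⟩ := mem_iUnion₂.1 hs
  have := endpoints_of_edge hd (mem_edgesOf.1 he).1 hse
  exact ⟨this.1, (mem_nodesOf.1 this.2).1⟩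

lemma isFlatPiece_face (hd : d = 2 ∨ d = 3) {σ : Set (E d)} (hσ : σ ∈ M.faces)
    (hb : Bornology.IsBounded σ) :
    IsFlatPiece (d - 2) σ (M.edgesOf σ) (M.edgeNormal σ) (M.edgeEnds σ) where
  isBounded := hb
  finrank_eq := by
    have := M.face_dim σ hσ
    omega
  relOpen := M.face_relOpen σ hσ
  boundary_eq := by
    rw [M.frontier_face σ hσ]
    ext x
    simp only [mem_iUnion, mem_union, edgeEnds, exists_prop, mem_edgesOf, mem_ofPred_eq, Set.mem_sdiff]
    constructor
    · rintro ⟨e, he, hx⟩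
      by_cases hxe : x ∈ e
      · exact Or.inl ⟨e, he, hxe⟩
      · exact Or.inr ⟨e, he, hx, hxe⟩
    · rintro (⟨e, he, hx⟩ | ⟨e, he, hx, -⟩)
      · exact ⟨e, he, subset_closure hx⟩
      · exact ⟨e, he, hx⟩
  pairwiseDisjoint := M.edges_disjoint.subset fun e he => (mem_edgesOf.1 he).1
  disjoint_null e he := disjoint_right.2 fun s hs => by
    have := edgeEnds_subset hd σ hs
    exact notMem_edge_of_node this.1 (mem_edgesOf.1 he).1 this.2
  closure_subset e he := by
    intro x hx
    by_cases hxe : x ∈ e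
    · exact Or.inl hxe
    · exact Or.inr (mem_iUnion₂.2 ⟨e, he, hx, hxe⟩)
  isOutwardNormal e he :=
    M.edgeNormal_spec σ hσ e (mem_edgesOf.1 he).1 (mem_edgesOf.1 he).2
  isCompact_null :=
    (M.nodes.finite_toSet.subset fun _ hs => (edgeEnds_subset hd σ hs).2).isCompact
  measure_null := by
    rcases hd with rfl | rfl
    · have h : M.edgeEnds σ = ∅ := eq_empty_of_forall_notMem fun s hs => by
        have := (edgeEnds_subset (Or.inl rfl) σ hs).1
        omega
      rw [h, measure_empty]
    · have := Measure.nullSingletonClass_hausdorff (E 3) (d := ((3 - 2 : ℕ) : ℝ)) (by norm_num)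
      exact (M.nodes.finite_toSet.subset
        fun _ hs => (edgeEnds_subset (Or.inr rfl) σ hs).2).measure_zero _
  measure_lt_top e he := measure_edge_lt_top hd (mem_edgesOf.1 he).1

/-- The edges of the faces of the cell `K`. -/
def skeleton (M : PolytopalMesh d) (K : Set (E d)) : Set (E d) :=
  ⋃ σ ∈ M.facesOf K, ⋃ e ∈ M.edgesOf σ, closure e

lemma closure_face_sdiff {σ : Set (E d)} (hσ : σ ∈ M.faces) :
    closure σ \ σ = ⋃ e ∈ M.edgesOf σ, closure e := by
  rw [M.frontier_face σ hσ]
  ext x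
  simp [mem_edgesOf]

lemma isBounded_cell {K : Set (E d)} (hK : K ∈ M.cells) : Bornology.IsBounded K :=
  M.isBounded_domain.subset (M.cell_subset K hK)

lemma isBounded_face {K σ : Set (E d)} (hK : K ∈ M.cells) (hσ : σ ∈ M.facesOf K) :
    Bornology.IsBounded σ :=
  (isBounded_cell hK).closure.subset (mem_facesOf.1 hσ).2

lemma vectorSpan_cell {K : Set (E d)} (hK : K ∈ M.cells) : vectorSpan ℝ K = ⊤ := by
  rw [← direction_affineSpan,
    (M.isOpen_cell K hK).affineSpan_eq_top (M.isConnected_cell K hK).nonempty,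
    AffineSubspace.direction_top]

lemma isFlatPiece_cell (hd : d = 2 ∨ d = 3) {K : Set (E d)} (hK : K ∈ M.cells) :
    IsFlatPiece (d - 1) K (M.facesOf K) (M.normal K) (M.skeleton K) where
  isBounded := isBounded_cell hK
  finrank_eq := by
    rw [vectorSpan_cell hK, finrank_top, finrank_euclideanSpace_fin]
    omega
  relOpen := ⟨K, M.isOpen_cell K hK, (inter_eq_left.2 (subset_affineSpan ℝ K)).symm⟩
  boundary_eq := by
    have h1 : closure K \ K = frontier K := by rw [frontier, (M.isOpen_cell K hK).interior_eq]
    rw [h1, M.frontier_cell K hK]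
    ext x
    simp only [mem_iUnion, mem_union, skeleton, exists_prop, mem_ofPred_eq, ← mem_facesOf]
    constructor
    · rintro ⟨σ, hσ, hx⟩
      by_cases hxσ : x ∈ σ
      · exact Or.inl ⟨σ, hσ, hxσ⟩
      · have hx' : x ∈ closure σ \ σ := ⟨hx, hxσ⟩
        rw [closure_face_sdiff (mem_facesOf.1 hσ).1] at hx'
        simp only [mem_iUnion, exists_prop] at hx'
        exact Or.inr ⟨σ, hσ, hx'⟩
    · rintro (⟨σ, hσ, hx⟩ | ⟨σ, hσ, e, he, hx⟩)
      · exact ⟨σ, hσ, subset_closure hx⟩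
      · refine ⟨σ, hσ, ?_⟩
        have : x ∈ closure σ \ σ := by
          rw [closure_face_sdiff (mem_facesOf.1 hσ).1]
          exact mem_iUnion₂.2 ⟨e, he, hx⟩
        exact this.1
  pairwiseDisjoint := M.faces_disjoint.subset fun σ hσ => (mem_facesOf.1 hσ).1
  disjoint_null σ hσ := disjoint_right.2 fun x hx hxσ => by
    obtain ⟨σ', -, hx⟩ := mem_iUnion₂.1 hx
    obtain ⟨e, he, hx⟩ := mem_iUnion₂.1 hx
    exact disjoint_left.1
      (M.face_edge_disjoint σ (mem_facesOf.1 hσ).1 e (mem_edgesOf.1 he).1) hxσ hx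
  closure_subset σ hσ := by
    intro x hx
    by_cases hxσ : x ∈ σ
    · exact Or.inl hxσ
    · have hx' : x ∈ closure σ \ σ := ⟨hx, hxσ⟩
      rw [closure_face_sdiff (mem_facesOf.1 hσ).1] at hx'
      exact Or.inr (mem_iUnion₂.2 ⟨σ, hσ, hx'⟩)
  isOutwardNormal σ hσ := M.normal_spec K hK σ (mem_facesOf.1 hσ).1 (mem_facesOf.1 hσ).2
  isCompact_null := (M.facesOf K).isCompact_biUnion fun σ _ =>
    (M.edgesOf σ).isCompact_biUnion fun e he => isCompact_closure_edge (mem_edgesOf.1 he).1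
  measure_null := by
    refine (measure_biUnion_null_iff (M.facesOf K).countable_toSet).2 fun σ _ => ?_
    refine (measure_biUnion_null_iff (M.edgesOf σ).countable_toSet).2 fun e he => ?_
    exact hausdorffMeasure_closure_edge hd (mem_edgesOf.1 he).1
  measure_lt_top σ hσ := by
    refine measure_lt_top_of_isBounded (isBounded_face hK hσ) ?_
    have := M.face_dim σ (mem_facesOf.1 hσ).1
    omega

end PolytopalMesh

/-! ### Reconstructions of interpolates -/

namespace PolytopalMesh

variable {d : ℕ} {M : PolytopalMesh d} {wt : M.NodalWeights}

lemma nodalValue_nodalInterp (K : M.cells) (f : E d → E d) (s : M.nodesOf K.1) :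
    nodalValue (nodalInterp K f) K s = f s :=
  if_pos rfl

lemma nodalValue_interp (K : M.cells) (f : E d → E d) (s : M.nodesOf K.1) :
    nodalValue (interp wt K f) K s = f s :=
  if_pos rfl

lemma faceMean_eq {u : M.Displacement} {K : M.cells} {f v : E d → E d}
    (hu : ∀ s, nodalValue u K s = f s) (σ : M.facesOf K.1)
    (hfv : ∀ s ∈ M.nodesOf σ.1, f s = v s) :
    faceMean wt u K σ = ∑ s ∈ M.nodesOf σ.1, wt.face σ.1 s • v s := by
  rw [← Finset.sum_coe_sort, faceMean]
  exact Finset.sum_congr rfl fun s _ => by rw [hu, hfv s s.2]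

lemma cellMean_eq {u : M.Displacement} {K : M.cells} {f v : E d → E d}
    (hu : ∀ s, nodalValue u K s = f s) (hfv : ∀ s ∈ M.nodesOf K.1, f s = v s) :
    cellMean wt u K = ∑ s ∈ M.nodesOf K.1, wt.cell K.1 s • v s := by
  rw [← Finset.sum_coe_sort, cellMean]
  exact Finset.sum_congr rfl fun s _ => by rw [hu, hfv s s.2]

/-- The mean of the nodal values of an edge is the mean value on the edge of the affine function which
interpolates them. -/
lemma integral_edge_eq (hd : d = 2 ∨ d = 3) {u : M.Displacement} {K : M.cells} {f v : E d → E d}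
    (hu : ∀ s, nodalValue u K s = f s) (σ : M.facesOf K.1)
    (hfv : ∀ s ∈ M.nodesOf σ.1, f s = v s) (hv : ContinuousOn v (closure σ.1))
    (e : M.edgesOf σ.1) {p : E d →ᵃ[ℝ] E d} (hp : EqOn v p e.1) :
    ∫ x in e.1, v x ∂μHE[d - 2] = edgeMeas e.1 • edgeMean u K σ e := by
  classical
  have he := mem_edgesOf.1 e.2
  obtain ⟨s₁, hs₁, s₂, hs₂, h12, hes, hcl, hn⟩ := exists_segment he.1
  have hecl : closure e.1 ⊆ closure σ.1 := closure_minimal he.2 isClosed_closure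
  have hpcl : EqOn v p (closure e.1) :=
    hp.of_subset_closure (hv.mono hecl) (continuous_affineMap p).continuousOn subset_closure le_rfl
  have hem : MeasurableSet e.1 := by
    have hnull : e.1 = closure e.1 \ (closure e.1 \ e.1) := by
      rw [sdiff_sdiff_cancel_left subset_closure]
    rw [hnull]
    refine isClosed_closure.measurableSet.diff
      (M.nodes.finite_toSet.subset fun s hs => ?_).measurableSet
    exact (mem_nodesOf.1 (endpoints_of_edge hd he.1 hs).2).1
  have hmean : edgeMean u K σ e = (1 / 2 : ℝ) • (p s₁ + p s₂) := by
    have h1 : edgeMean u K σ e =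
        (1 / ((M.nodesOf e.1).card : ℝ)) • ∑ s ∈ M.nodesOf e.1, p s := by
      rw [edgeMean, ← Finset.sum_coe_sort (M.nodesOf e.1)]
      congr 1
      refine Finset.sum_congr rfl fun s _ => ?_
      rw [hu, hfv s (nodesOf_mono (edge_subset_closure e.2) s.2),
        hpcl (mem_nodesOf.1 s.2).2]
    have h2 : M.nodesOf e.1 = {s₁, s₂} := by
      ext s
      rw [Finset.mem_insert, Finset.mem_singleton]
      refine ⟨hn s, ?_⟩
      rintro (rfl | rfl) <;> assumption
    rw [h1, h2]
    by_cases h : s₁ = s₂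
    · subst h
      simp only [Finset.insert_eq_of_mem, Finset.mem_singleton, Finset.card_singleton,
        Finset.sum_singleton, Nat.cast_one]
      module
    · rw [Finset.card_pair h, Finset.sum_pair h]
      norm_num
  have htop := measure_edge_lt_top hd he.1
  rw [setIntegral_congr_fun hem hp, hmean, edgeMeas]
  rw [hes] at htop hem ⊢
  exact setIntegral_openSegment s₁ s₂ htop hem p

/-- The reconstructed tangential gradient of an interpolate is the mean value of the weak gradient,
by the divergence theorem on the face. -/
lemma integral_face_weakGrad (hd : d = 2 ∨ d = 3) {u : M.Displacement} {K : M.cells}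
    {f v : E d → E d} (hu : ∀ s, nodalValue u K s = f s) (σ : M.facesOf K.1)
    (hfv : ∀ s ∈ M.nodesOf σ.1, f s = v s) (hv : ContinuousOn v (closure σ.1))
    (hp : ∀ e ∈ M.edgesOf σ.1, ∃ p : E d →ᵃ[ℝ] E d, EqOn v p e)
    {G : E d → E d →L[ℝ] E d} (hG : HasWeakGrad σ.1 μHE[d - 1] v G) :
    ∫ x in σ.1, G x ∂μHE[d - 1] = (μHE[d - 1] σ.1).toReal • faceGrad u K σ := by
  have h := isFlatPiece_face hd (mem_facesOf.1 σ.2).1 (isBounded_face K.2 σ.2)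
  have hd1 : d - 2 + 1 = d - 1 := by omega
  have hpos := ENNReal.toReal_pos h.measure_pos.ne' h.measure_lt_top'.ne
  have hint := h.integral_weakGrad_eq_sum_tensor hv (hd1.symm ▸ hG)
  rw [hd1] at hint hpos
  rw [hint, faceGrad, faceMeas, smul_smul, mul_one_div_cancel hpos.ne', one_smul,
    ← Finset.sum_coe_sort]
  refine Finset.sum_congr rfl fun e _ => ?_
  obtain ⟨p, hp⟩ := hp e e.2
  rw [integral_edge_eq hd hu σ hfv hv e hp, tensor_smul_left]

lemma faceGrad_comp_starProjection (u : M.Displacement) (K : M.cells) (σ : M.facesOf K.1) :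
    (faceGrad u K σ).comp (vectorSpan ℝ σ.1).starProjection = faceGrad u K σ := by
  ext1 x
  simp only [faceGrad, ContinuousLinearMap.comp_apply, smul_apply, sum_apply, tensor_apply]
  congr 1
  refine Finset.sum_congr rfl fun e _ => ?_
  have he := mem_edgesOf.1 e.2
  have hn := (M.edgeNormal_spec σ.1 (mem_facesOf.1 σ.2).1 e.1 he.1 he.2).tangent
  have := Submodule.inner_right_of_mem_orthogonal hn
    (Submodule.sub_starProjection_mem_orthogonal (K := vectorSpan ℝ σ.1) x)
  rw [inner_sub_right, sub_eq_zero] at this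
  rw [this]

lemma sum_smul_mem_affineSpan {A : Set (E d)} {c : E d → ℝ} (hc : ∑ s ∈ M.nodesOf A, c s = 1) :
    ∑ s ∈ M.nodesOf A, c s • s ∈ affineSpan ℝ A := by
  have h := affineCombination_mem_affineSpan (s := (M.nodesOf A).attach) (w := fun s => c s.1)
    (by rw [← hc, Finset.sum_attach _ c]) (fun s : M.nodesOf A => s.1)
  rw [Finset.affineCombination_eq_linear_combination _ _ _
    (by rw [← hc, Finset.sum_attach _ c]), Finset.sum_attach _ fun s => c s • s] at h
  refine affineSpan_le.2 ?_ h
  rintro _ ⟨s, rfl⟩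
  exact closure_subset_affineSpan A (mem_nodesOf.1 s.2).2

lemma integral_faceRec (hd : d = 2 ∨ d = 3) (u : M.Displacement) (K : M.cells)
    (σ : M.facesOf K.1) :
    ∫ x in σ.1, faceRec wt u K σ x ∂μHE[d - 1] = faceMeas σ.1 • faceMean wt u K σ := by
  have hb := isBounded_face K.2 σ.2
  have h := isFlatPiece_face hd (mem_facesOf.1 σ.2).1 hb
  have hd1 : d - 2 + 1 = d - 1 := by omega
  have h0 := h.measure_pos
  have h1 := h.measure_lt_top'
  rw [hd1] at h0 h1
  exact setIntegral_affineAt hb h.measurableSet h0 h1 _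
    (wt.face_center σ.1 (mem_facesOf.1 σ.2).1) _

lemma integrableOn_face (hd : d = 2 ∨ d = 3) {K : M.cells} (σ : M.facesOf K.1) {f : E d → E d}
    (hf : ContinuousOn f (closure σ.1)) : IntegrableOn f σ.1 μHE[d - 1] := by
  have hb := isBounded_face K.2 σ.2
  have h := isFlatPiece_face hd (mem_facesOf.1 σ.2).1 hb
  have hd1 : d - 2 + 1 = d - 1 := by omega
  have h1 := h.measure_lt_top'
  rw [hd1] at h1
  exact integrableOn_of_continuousOn hb h.measurableSet h1 hf

/-- On a face without bubble, the moment conditions prescribe the mean value of the elements of the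
face space, since the constants are admissible test functions. -/
lemma integral_face_of_notMem (hd : d = 2 ∨ d = 3)
    {Q : Set (E d) → (σ : Set (E d)) → Submodule ℝ (σ → ℝ)} {K : M.cells} (σ : M.facesOf K.1)
    {v : E d → E d} (hv : v ∈ faceSpace wt Q K σ) (hσ : σ.1 ∉ M.plusFaces K.1) :
    ∫ x in σ.1, v x ∂μHE[d - 1] =
      faceMeas σ.1 • ∑ s ∈ M.nodesOf σ.1, wt.face σ.1 s • v s := by
  obtain ⟨hc, -, -, hmom⟩ := hv
  have h1 : ∫ x in σ.1, faceProj wt K σ v x ∂μHE[d - 1] =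
      faceMeas σ.1 • ∑ s ∈ M.nodesOf σ.1, wt.face σ.1 s • v s := by
    rw [faceProj, integral_faceRec hd, faceMean_eq (nodalValue_interp K _) σ fun s hs => ?_]
    exact indicator_of_mem (mem_nodesOf.1 hs).2 v
  rw [← h1]
  refine (ext_inner_right ℝ fun c => ?_).symm
  have h2 := hmom (AffineMap.const ℝ (E d) c) fun i => by
    rw [faceTest, if_neg hσ]
    exact ⟨AffineMap.const ℝ (E d) (c i), fun x => rfl⟩
  simp only [AffineMap.const_apply] at h2
  simp_rw [real_inner_comm] at h2 ⊢
  rwa [integral_inner (integrableOn_face hd σ (continuous_affineMap _).continuousOn),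
    integral_inner (integrableOn_face hd σ hc)] at h2

/-- On a face with a bubble, the bubble component of the interpolate corrects the mean value of the
nodal reconstruction. -/
lemma integral_face_of_mem (hd : d = 2 ∨ d = 3) {K : M.cells} (σ : M.plusFaces K.1)
    {v : E d → E d} (hv : ContinuousOn v (closure K.1)) :
    faceMeas σ.1 • (interp wt K ((closure K.1).indicator v)).2 K σ =
      ∫ x in σ.1, v x ∂μHE[d - 1] -
        faceMeas σ.1 • ∑ s ∈ M.nodesOf σ.1, wt.face σ.1 s • v s := by
  have hσ := plusFaces_subset K.1 σ.2
  have hb := isBounded_face K.2 hσ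
  have h := isFlatPiece_face hd (mem_facesOf.1 hσ).1 hb
  have hd1 : d - 2 + 1 = d - 1 := by omega
  have hpos := ENNReal.toReal_pos h.measure_pos.ne' h.measure_lt_top'.ne
  rw [hd1] at hpos
  have hcl : closure σ.1 ⊆ closure K.1 := closure_minimal (mem_facesOf.1 hσ).2 isClosed_closure
  have hmean : faceMean wt (nodalInterp K ((closure K.1).indicator v)) K ⟨σ.1, hσ⟩ =
      ∑ s ∈ M.nodesOf σ.1, wt.face σ.1 s • v s :=
    faceMean_eq (nodalValue_nodalInterp K _) ⟨σ.1, hσ⟩ fun s hs =>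
      indicator_of_mem (hcl (mem_nodesOf.1 hs).2) v
  have h1 : (interp wt K ((closure K.1).indicator v)).2 K σ = (1 / faceMeas σ.1) •
      ∫ x in σ.1, (v x - faceRec wt (nodalInterp K ((closure K.1).indicator v)) K ⟨σ.1, hσ⟩ x)
        ∂μHE[d - 1] := by
    simp only [interp]
    congr 1
    refine setIntegral_congr_fun h.measurableSet fun x hx => ?_
    simp only [if_true, indicator_of_mem (hcl (subset_closure hx))]
  rw [h1, smul_smul, faceMeas, mul_one_div_cancel hpos.ne', one_smul,
    integral_sub (integrableOn_face hd ⟨σ.1, hσ⟩ (hv.mono hcl))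
      (integrableOn_face hd ⟨σ.1, hσ⟩ (continuous_affineMap _).continuousOn),
    integral_faceRec hd, hmean]
  rfl

/-- The reconstructed gradient of an interpolate is the mean value of the weak gradient, by the
divergence theorem on the cell. -/
lemma integral_cell_weakGrad (hd : d = 2 ∨ d = 3)
    {Q : Set (E d) → (σ : Set (E d)) → Submodule ℝ (σ → ℝ)} {K : M.cells}
    {v : E d → E d} (hv : v ∈ cellSpace wt Q K)
    {G : E d → E d →L[ℝ] E d} (hG : HasWeakGrad K.1 volume v G) :
    ∫ x in K.1, G x =
      (volume K.1).toReal • cellGrad wt (interp wt K ((closure K.1).indicator v)) K := by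
  classical
  obtain ⟨hc, hface, -, -⟩ := hv
  have h := isFlatPiece_cell hd K.2
  have hvol : (μHE[d - 1 + 1] : Measure (E d)) = volume := by
    rw [show d - 1 + 1 = d by omega]
    exact EuclideanSpace.euclideanHausdorffMeasure_eq_volume d
  have hpos := ENNReal.toReal_pos h.measure_pos.ne' h.measure_lt_top'.ne
  have hint := h.integral_weakGrad_eq_sum_tensor hc (hvol.symm ▸ hG)
  rw [hvol] at hint hpos
  set u := interp wt K ((closure K.1).indicator v) with hu
  set a : Set (E d) → E d := fun σ => ∑ s ∈ M.nodesOf σ, wt.face σ s • v s with ha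
  have hmean : ∀ σ : M.facesOf K.1, faceMean wt u K σ = a σ.1 := fun σ =>
    faceMean_eq (nodalValue_interp K _) σ fun s hs =>
      indicator_of_mem (closure_minimal (mem_facesOf.1 σ.2).2 isClosed_closure
        (mem_nodesOf.1 hs).2) v
  have h1 : (volume K.1).toReal • cellGrad wt u K =
      (∑ σ ∈ M.plusFaces K.1, (tensor (∫ x in σ, v x ∂μHE[d - 1]) (M.normal K.1 σ) -
        tensor (faceMeas σ • a σ) (M.normal K.1 σ))) +
      ∑ σ ∈ M.facesOf K.1, tensor (faceMeas σ • a σ) (M.normal K.1 σ) := by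
    have hcancel : ∀ r : ℝ, (volume K.1).toReal * (r / cellMeas K.1) = r := fun r => by
      rw [cellMeas, mul_div_cancel₀ r hpos.ne']
    rw [cellGrad, smul_add, Finset.smul_sum, Finset.smul_sum, ← Finset.sum_coe_sort (M.plusFaces K.1),
      ← Finset.sum_coe_sort (M.facesOf K.1)]
    congr 1
    · refine Finset.sum_congr rfl fun σ _ => ?_
      rw [smul_smul, hcancel, ← tensor_smul_left, ← tensor_sub_left, hu, integral_face_of_mem hd σ hc]
    · refine Finset.sum_congr rfl fun σ _ => ?_
      rw [smul_smul, hcancel, ← tensor_smul_left, hmean]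
  rw [hint, h1, Finset.sum_sub_distrib, ← Finset.sum_sdiff (plusFaces_subset K.1),
    ← Finset.sum_sdiff (plusFaces_subset K.1) (f := fun σ => tensor (faceMeas σ • a σ) _)]
  have h2 : ∑ σ ∈ M.facesOf K.1 \ M.plusFaces K.1,
      tensor (∫ x in σ, v x ∂μHE[d - 1]) (M.normal K.1 σ) =
      ∑ σ ∈ M.facesOf K.1 \ M.plusFaces K.1, tensor (faceMeas σ • a σ) (M.normal K.1 σ) := by
    refine Finset.sum_congr rfl fun σ hσ => ?_
    rw [Finset.mem_sdiff] at hσ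
    rw [integral_face_of_notMem hd ⟨σ, hσ.1⟩ (hface ⟨σ, hσ.1⟩) hσ.2]
  rw [h2]
  abel

end PolytopalMesh

end BubbleVEM

end

open BubbleVEM BubbleVEM.PolytopalMesh in
theorem mainTheorem2 (d : ℕ) (hd : d = 2 ∨ d = 3) (M : BubbleVEM.PolytopalMesh d)
    (wt : M.NodalWeights)
    (Q : Set (BubbleVEM.E d) → (σ : Set (BubbleVEM.E d)) → Submodule ℝ (σ → ℝ))
    (hQ : M.IsBubbleComplement Q) (K : M.cells) :
    (∀ v ∈ BubbleVEM.PolytopalMesh.cellSpace wt Q K, ∀ w : BubbleVEM.E d →ᵃ[ℝ] BubbleVEM.E d,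
      BubbleVEM.IsEllipticProjection K.1 volume (BubbleVEM.PolytopalMesh.cellCenter wt K.1)
          (∑ s ∈ M.nodesOf K.1, wt.cell K.1 s • v s) v w ↔
        w = BubbleVEM.PolytopalMesh.cellProj wt K v) ∧
    (∀ σ : M.facesOf K.1, ∀ v ∈ BubbleVEM.PolytopalMesh.faceSpace wt Q K σ,
      ∀ w : BubbleVEM.E d →ᵃ[ℝ] BubbleVEM.E d,
        BubbleVEM.IsEllipticProjection σ.1 μHE[d - 1]
            (BubbleVEM.PolytopalMesh.faceCenter wt σ.1)
            (∑ s ∈ M.nodesOf σ.1, wt.face σ.1 s • v s) v w ↔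
          EqOn w (BubbleVEM.PolytopalMesh.faceProj wt K σ v) σ.1) := by
  constructor
  · intro v hv w
    have h := isFlatPiece_cell hd K.2
    have hvol : (μHE[d - 1 + 1] : Measure (E d)) = volume := by
      rw [show d - 1 + 1 = d by omega]
      exact EuclideanSpace.euclideanHausdorffMeasure_eq_volume d
    have h0 := h.measure_pos
    have htop := h.measure_lt_top'
    rw [hvol] at h0 htop
    have hD : (cellGrad wt (interp wt K ((closure K.1).indicator v)) K).comp
        (vectorSpan ℝ K.1).starProjection =
          cellGrad wt (interp wt K ((closure K.1).indicator v)) K := by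
      ext1 x
      rw [ContinuousLinearMap.comp_apply, Submodule.starProjection_eq_self_iff.2]
      rw [vectorSpan_cell K.2]
      trivial
    have hmean : cellMean wt (interp wt K ((closure K.1).indicator v)) K =
        ∑ s ∈ M.nodesOf K.1, wt.cell K.1 s • v s :=
      cellMean_eq (nodalValue_interp K _) fun s hs => indicator_of_mem (mem_nodesOf.1 hs).2 v
    have hc : cellCenter wt K.1 ∈ affineSpan ℝ K.1 := sum_smul_mem_affineSpan (wt.cell_sum K.1 K.2)
    rw [isEllipticProjection_iff h0 htop (hv.2.2.1.imp fun G hG => hG.1) hD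
      fun G hG => integral_cell_weakGrad hd hv hG, ← eqOn_affineAt_iff hD hc, ← hmean]
    refine ⟨fun heq => ?_, fun heq => heq ▸ fun x _ => rfl⟩
    have hKspan : (affineSpan ℝ K.1) = ⊤ :=
      (M.isOpen_cell K.1 K.2).affineSpan_eq_top (M.isConnected_cell K.1 K.2).nonempty
    exact AffineMap.ext_on hKspan heq
  · intro σ v hv w
    have h := isFlatPiece_face hd (mem_facesOf.1 σ.2).1 (isBounded_face K.2 σ.2)
    have h0 := h.measure_pos
    have htop := h.measure_lt_top'
    rw [show d - 2 + 1 = d - 1 by omega] at h0 htop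
    have hfv : ∀ s ∈ M.nodesOf σ.1, (closure σ.1).indicator v s = v s :=
      fun s hs => indicator_of_mem (mem_nodesOf.1 hs).2 v
    have hD := faceGrad_comp_starProjection (interp wt K ((closure σ.1).indicator v)) K σ
    have hc : faceCenter wt σ.1 ∈ affineSpan ℝ σ.1 :=
      sum_smul_mem_affineSpan (wt.face_sum σ.1 (mem_facesOf.1 σ.2).1)
    rw [isEllipticProjection_iff h0 htop (hv.2.2.1.imp fun G hG => hG.1) hD
      fun G hG => integral_face_weakGrad hd (nodalValue_interp K _) σ hfv hv.1 hv.2.1 hG,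
      ← eqOn_affineAt_iff hD hc, ← faceMean_eq (nodalValue_interp K _) σ hfv]
    rfl
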